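/- Let $A$ be a regular local ring (in particular Noetherian) with maximal ideal $I$, and let $L_0\colon \mathrm{Mod}_A\to\mathrm{Mod}_A$ be the zeroth left derived functor of $I$-adic completion, with its natural map $\eta\colon M\to L_0M$. An $A$-module $M$ is $L$-complete if $\eta\colon M\to L_0M$ is an isomorphism. Tensor products are over $A$, and $M\boxtimes N:=L_0(M\otimes N)$. Let $(A,\Psi)$ be a Hopf algebroid (a cogroupoid object in commutative rings) with units $\eta_L,\eta_R\colon A\to\Psi$, diagonal $\Delta\colon\Psi\to\Psi\otimes\Psi$ and counit $\epsilon\colon\Psi\to A$. Assume that $\Psi$ is flat over $A$ and that $I$ is invariant, i.e. $\eta_R(I)\Psi\subseteq \eta_L(I)\Psi$. Write $\widehat A=L_0A$, let $\widehat\Psi=L_0\Psi$ be the $L$-completion of $\Psi$, an $A$-bimodule, and let $\widehat\Delta\colon\widehat\Psi\to\widehat\Psi\boxtimes\widehat\Psi$ and $\widehat\epsilon\colon\widehat\Psi\to\widehat A$ be induced by $\Delta$ and $\epsilon$. An $L$-complete comodule is an $L$-complete module $N$ with a linear map $\widehat\psi_N\colon N\to\widehat\Psi\boxtimes N$ that is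 counital, $(\widehat\epsilon\boxtimes 1)\widehat\psi_N=1$, and coassociative, $(\widehat\Delta\boxtimes1)\widehat\psi_N=(1\boxtimes\widehat\psi_N)\widehat\psi_N$, up to the unit and associativity isomorphisms of $\boxtimes$. For such $N$ consider the maps $$j\colon \Psi\otimes N\xrightarrow{\ \eta\ }\Psi\boxtimes N\cong\widehat\Psi\boxtimes N,\qquad j'\colon\Psi\otimes(\Psi\boxtimes N)\xrightarrow{\ \eta\ }\Psi\boxtimes(\Psi\boxtimes N)\cong\widehat\Psi\boxtimes(\widehat\Psi\boxtimes N),$$ and let $\nu N$ be the pullback of $A$-modules $$\nu N = N\times_{\widehat\Psi\boxtimes N}(\Psi\otimes N)$$ of $\widehat\psi_N$ and $j$, with projections $i\colon\nu N\to N$ and $p\colon\nu N\to\Psi\otimes N$. **Proposition.** Let $N$ be an $L$-complete comodule such that $j$ and $j'$ are injective. Then $i\colon\nu N\to N$ is injective, so that $\nu N$ is a submodule of $N$, and there is an $A$-linear coaction $\rho\colon\nu N\to\Psi\otimes\nu N$, counital and coassociative, which makes $\nu N$ a $\Psi$-comodule and satisfies $(1\otimes i)\rho=p$. -/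

import Mathlib

open CategoryTheory
open scoped TensorProduct

universe u

noncomputable section

namespace LComp

/-! ### L-completion: the zeroth left derived functor of adic completion -/

section Completion

variable {A : Type u} [CommRing A]

/-- The `I`-adic completion functor `C^I`, as an endofunctor of `A`-modules. -/
def adicFunctor (I : Ideal A) : ModuleCat.{u} A ⥤ ModuleCat.{u} A where
  obj M := ModuleCat.of A (AdicCompletion I M)
  map f := ModuleCat.ofHom ((AdicCompletion.map I f.hom).restrictScalars A)
  map_id M := by
    apply ModuleCat.hom_ext
    apply LinearMap.ext
    intro x
    exact congrArg (fun g => g x) (AdicCompletion.map_id I (M := M))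
  map_comp f g := by
    apply ModuleCat.hom_ext
    apply LinearMap.ext
    intro x
    exact (AdicCompletion.map_comp_apply I f.hom g.hom x).symm

instance (I : Ideal A) : (adicFunctor I).Additive where
  map_add {M N f g} := by
    apply ModuleCat.hom_ext
    apply LinearMap.ext
    intro x
    induction x using AdicCompletion.induction_on with
    | _ x =>
      change AdicCompletion.map I (f.hom + g.hom) _ =
        AdicCompletion.map I f.hom _ + AdicCompletion.map I g.hom _
      apply AdicCompletion.ext
      intro n
      simp

/-- The canonical map `M → C^I(M)`, natural in `M`. -/
def toAdic (I : Ideal A) : 𝟭 (ModuleCat.{u} A) ⟶ adicFunctor I where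
  app M := ModuleCat.ofHom (AdicCompletion.of I M)
  naturality M N f := by
    ext x
    exact (AdicCompletion.map_of I f.hom x).symm

/-- `L`-completion `L₀` with respect to `I`: the zeroth left derived functor of `C^I`. -/
def L₀ (I : Ideal A) : ModuleCat.{u} A ⥤ ModuleCat.{u} A :=
  (adicFunctor I).leftDerived 0

instance (I : Ideal A) : (L₀ I).Additive where
  map_add {M N f g} := by
    let P := projectiveResolution M
    let Q := projectiveResolution N
    have hw : (ProjectiveResolution.lift f P Q + ProjectiveResolution.lift g P Q) ≫ Q.π =
        P.π ≫ (ChainComplex.single₀ _).map (f + g) := by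
      rw [Preadditive.add_comp, ProjectiveResolution.lift_commutes,
        ProjectiveResolution.lift_commutes, ← Preadditive.comp_add]
      congr 1
      exact ((ChainComplex.single₀ (ModuleCat.{u} A)).map_add).symm
    simp only [L₀]
    rw [Functor.leftDerived_map_eq (adicFunctor I) 0 (f + g) _ hw,
      Functor.leftDerived_map_eq (adicFunctor I) 0 f (ProjectiveResolution.lift f P Q)
        (ProjectiveResolution.lift_commutes f P Q),
      Functor.leftDerived_map_eq (adicFunctor I) 0 g (ProjectiveResolution.lift g P Q)
        (ProjectiveResolution.lift_commutes g P Q), Functor.map_add, Preadditive.add_comp,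
      Preadditive.comp_add]
    rfl

/-- The natural map `η : M → L₀ M`: the map that `M → C^I(M)` induces on zeroth left derived
functors, the zeroth left derived functor of the identity being the identity. -/
def η (I : Ideal A) : 𝟭 (ModuleCat.{u} A) ⟶ L₀ I :=
  (𝟭 (ModuleCat.{u} A)).leftDerivedZeroIsoSelf.inv ≫ NatTrans.leftDerived (toAdic I) 0

/-- `M` is `L`-complete when `η : M → L₀ M` is an isomorphism. -/
def IsLComplete (I : Ideal A) (M : ModuleCat.{u} A) : Prop :=
  IsIso ((η I).app M)

end Completion

/-! ### Bimodules over a commutative ring, with two possibly different actions -/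

/-- An `A`-bimodule: a left `A`-module together with a right action of `A` (recall that `A` is
commutative) by left-linear endomorphisms; `act a x` is `x · a`. -/
structure Bimod (A : Type u) [CommRing A] where
  left : ModuleCat.{u} A
  act : A →+* Module.End A left

namespace Bimod

variable {A : Type u} [CommRing A]

/-- Morphisms of bimodules. -/
@[ext]
structure Hom (X Y : Bimod A) where
  hom : X.left ⟶ Y.left
  comm : ∀ (a : A) (x : X.left), hom (X.act a x) = Y.act a (hom x)

instance : Category (Bimod A) where
  Hom := Hom
  id X := ⟨𝟙 X.left, fun _ _ => rfl⟩
  comp f g := ⟨f.hom ≫ g.hom, fun a x => by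
    simp only [ModuleCat.comp_apply, f.comm, g.comm]⟩

/-- The underlying group of a bimodule, as an `A`-module through the right action. -/
def Right (X : Bimod A) : Type u := X.left

instance (X : Bimod A) : AddCommGroup X.Right := inferInstanceAs (AddCommGroup X.left)

instance (X : Bimod A) : Module A X.Right := Module.compHom X.left X.act

/-- A morphism of bimodules, as a linear map for the right actions. -/
def Hom.right {X Y : Bimod A} (f : X ⟶ Y) : X.Right →ₗ[A] Y.Right where
  toFun x := Hom.hom f (x : X.left)
  map_add' x y := map_add (Hom.hom f).hom x y
  map_smul' a x := Hom.comm f a x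

/-- Left multiplication by `a`. -/
def leftMul (X : Bimod A) (a : A) (x : X.left) : X.left := a • x

/-- The left action, by endomorphisms that are linear for the right action. -/
def lmul (X : Bimod A) : A →+* Module.End A X.Right where
  toFun a :=
    { toFun := X.leftMul a
      map_add' := fun x y => smul_add a (show X.left from x) (show X.left from y)
      map_smul' := fun b x => ((X.act b).map_smul a (show X.left from x)).symm }
  map_one' := LinearMap.ext fun x => one_smul A (show X.left from x)
  map_mul' a b := LinearMap.ext fun x => mul_smul a b (show X.left from x)
  map_zero' := LinearMap.ext fun x => zero_smul A (show X.left from x)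
  map_add' a b := LinearMap.ext fun x => add_smul a b (show X.left from x)

/-- `X ⊗_A N`: the tensor product over `A` of the right `A`-module underlying `X` with `N`, as an
`A`-module through the left action on `X`. -/
def tensor (X : Bimod A) (N : ModuleCat.{u} A) : ModuleCat.{u} A :=
  @ModuleCat.of A _ (X.Right ⊗[A] N) _
    (Module.compHom (X.Right ⊗[A] N)
      ((Module.End.rTensorAlgHom A X.Right N).toRingHom.comp X.lmul))

/-- The pure tensor `x ⊗ n`. -/
def tmul (X : Bimod A) {N : ModuleCat.{u} A} (x : X.left) (n : N) : X.tensor N :=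
  TensorProduct.tmul A (show X.Right from x) n

theorem smul_eq (X : Bimod A) {N : ModuleCat.{u} A} (a : A) (t : X.Right ⊗[A] N) :
    (a • (show X.tensor N from t) : X.tensor N) = (X.lmul a).rTensor N t := rfl

theorem smul_tmul (X : Bimod A) {N : ModuleCat.{u} A} (a : A) (x : X.left) (n : N) :
    a • X.tmul x n = X.tmul (a • x) n := rfl

theorem act_tmul (X : Bimod A) {N : ModuleCat.{u} A} (a : A) (x : X.left) (n : N) :
    X.tmul (X.act a x) n = X.tmul x (a • n) :=
  TensorProduct.smul_tmul a (show X.Right from x) n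

/-- The map `f ⊗ g : X ⊗_A N → Y ⊗_A N'`. -/
def tensorMap {X Y : Bimod A} {N N' : ModuleCat.{u} A} (f : X ⟶ Y) (g : N ⟶ N') :
    X.tensor N ⟶ Y.tensor N' :=
  @ModuleCat.ofHom A _ (X.tensor N) (Y.tensor N') _ _ _ _
    { toFun := TensorProduct.map (Hom.right f) g.hom
      map_add' := fun s t => map_add (TensorProduct.map (Hom.right f) g.hom) s t
      map_smul' := fun a t => by
        have h : TensorProduct.map (Hom.right f) g.hom ∘ₗ (X.lmul a).rTensor N =
            (Y.lmul a).rTensor N' ∘ₗ TensorProduct.map (Hom.right f) g.hom := by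
          apply TensorProduct.ext'
          intro x n
          have hx : Hom.hom f (a • (show X.left from x)) = a • Hom.hom f (show X.left from x) :=
            map_smul (Hom.hom f).hom a (show X.left from x)
          exact congrArg (fun y : Y.Right => TensorProduct.tmul A y (g.hom n)) hx
        exact LinearMap.congr_fun h t }

theorem tensorMap_apply {X Y : Bimod A} {N N' : ModuleCat.{u} A} (f : X ⟶ Y) (g : N ⟶ N')
    (t : X.Right ⊗[A] N) :
    tensorMap f g (show X.tensor N from t) = TensorProduct.map (Hom.right f) g.hom t := rfl

/-- The tensor product `X ⊗_A Y` of bimodules, with the left action on `X` and the right action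
on `Y`. -/
def prod (X Y : Bimod A) : Bimod A where
  left := X.tensor Y.left
  act :=
    { toFun := fun a => (tensorMap (𝟙 X) (ModuleCat.ofHom (Y.act a))).hom
      map_one' := by
        apply LinearMap.ext
        intro t
        change TensorProduct.map LinearMap.id (Y.act 1) t = t
        rw [map_one]
        exact LinearMap.congr_fun TensorProduct.map_id t
      map_mul' := fun a b => by
        apply LinearMap.ext
        intro t
        change (Y.act (a * b)).lTensor X.Right t =
          (Y.act a).lTensor X.Right ((Y.act b).lTensor X.Right t)
        rw [map_mul, LinearMap.lTensor_mul]
        rfl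
      map_zero' := by
        apply LinearMap.ext
        intro t
        change (Y.act 0).lTensor X.Right t = 0
        rw [map_zero, LinearMap.lTensor_zero]
        rfl
      map_add' := fun a b => by
        apply LinearMap.ext
        intro t
        change (Y.act (a + b)).lTensor X.Right t =
          (Y.act a).lTensor X.Right t + (Y.act b).lTensor X.Right t
        rw [map_add, LinearMap.lTensor_add]
        rfl }

/-- The map `f ⊗ g` of bimodules. -/
def prodMap {X X' Y Y' : Bimod A} (f : X ⟶ X') (g : Y ⟶ Y') : X.prod Y ⟶ X'.prod Y' where
  hom := tensorMap f (Hom.hom g)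
  comm a t := by
    change TensorProduct.map (Hom.right f) (Hom.hom g).hom ((Y.act a).lTensor X.Right t) =
      (Y'.act a).lTensor X'.Right (TensorProduct.map (Hom.right f) (Hom.hom g).hom t)
    have h : TensorProduct.map (Hom.right f) (Hom.hom g).hom ∘ₗ (Y.act a).lTensor X.Right =
        (Y'.act a).lTensor X'.Right ∘ₗ TensorProduct.map (Hom.right f) (Hom.hom g).hom := by
      apply TensorProduct.ext'
      intro x y
      exact congrArg (fun z => TensorProduct.tmul A (Hom.right f x) z) (Hom.comm g a y)
    exact LinearMap.congr_fun h t

/-- For fixed `n`, the left-linear map `y ↦ y ⊗ n`. -/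
def tmulBy (Y : Bimod A) {N : ModuleCat.{u} A} (n : N) : Y.left ⟶ Y.tensor N :=
  @ModuleCat.ofHom A _ Y.left (Y.tensor N) _ _ _ _
    { toFun := fun y => Y.tmul y n
      map_add' := fun y z => TensorProduct.add_tmul (show Y.Right from y) (show Y.Right from z) n
      map_smul' := fun a y => by
        change Y.tmul (a • y) n = a • Y.tmul y n
        rfl }

theorem tmulBy_add (Y : Bimod A) {N : ModuleCat.{u} A} (m n : N) :
    (tmulBy Y (m + n)).hom = (tmulBy Y m).hom + (tmulBy Y n).hom :=
  LinearMap.ext fun y => TensorProduct.tmul_add (show Y.Right from y) m n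

/-- The underlying additive map of `assoc`. -/
def assocAux (X Y : Bimod A) (N : ModuleCat.{u} A) :
    (X.prod Y).Right ⊗[A] N →+ X.Right ⊗[A] (Y.tensor N) :=
  TensorProduct.liftAddHom
    { toFun := fun w =>
        AddMonoidHom.mk'
          (fun n => (tmulBy Y n).hom.lTensor X.Right (show X.Right ⊗[A] Y.left from w))
          (fun m n => by rw [tmulBy_add, LinearMap.lTensor_add]; rfl)
      map_zero' := AddMonoidHom.ext fun n => map_zero ((tmulBy Y n).hom.lTensor X.Right)
      map_add' := fun v w => AddMonoidHom.ext fun n =>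
        map_add ((tmulBy Y n).hom.lTensor X.Right) (show X.Right ⊗[A] Y.left from v)
          (show X.Right ⊗[A] Y.left from w) }
    (fun a w n => by
      change (tmulBy Y n).hom.lTensor X.Right
          ((Y.act a).lTensor X.Right (show X.Right ⊗[A] Y.left from w)) =
        (tmulBy Y (a • n)).hom.lTensor X.Right (show X.Right ⊗[A] Y.left from w)
      have h : (tmulBy Y n).hom ∘ₗ Y.act a = (tmulBy Y (a • n)).hom :=
        LinearMap.ext fun y => TensorProduct.smul_tmul a (show Y.Right from y) n
      rw [← h, LinearMap.lTensor_comp]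
      rfl)

/-- The associativity isomorphism `(X ⊗_A Y) ⊗_A N → X ⊗_A (Y ⊗_A N)`, as a map:
`(x ⊗ y) ⊗ n ↦ x ⊗ (y ⊗ n)`. -/
def assoc (X Y : Bimod A) (N : ModuleCat.{u} A) :
    (X.prod Y).tensor N ⟶ X.tensor (Y.tensor N) :=
  @ModuleCat.ofHom A _ ((X.prod Y).tensor N) (X.tensor (Y.tensor N)) _ _ _ _
    { toFun := assocAux X Y N
      map_add' := fun s t => map_add (assocAux X Y N) s t
      map_smul' := fun a t => by
        change assocAux X Y N (((X.prod Y).lmul a).rTensor N t) =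
          (X.lmul a).rTensor (Y.tensor N) (assocAux X Y N t)
        refine TensorProduct.induction_on (motive := fun t =>
          assocAux X Y N (((X.prod Y).lmul a).rTensor N t) =
          (X.lmul a).rTensor (Y.tensor N) (assocAux X Y N t)) t ?_ ?_ ?_
        · simp
        · intro w n
          change (tmulBy Y n).hom.lTensor X.Right
              ((X.lmul a).rTensor Y.left (show X.Right ⊗[A] Y.left from w)) =
            (X.lmul a).rTensor (Y.tensor N)
              ((tmulBy Y n).hom.lTensor X.Right (show X.Right ⊗[A] Y.left from w))
          rw [← LinearMap.comp_apply, ← LinearMap.comp_apply, LinearMap.lTensor_comp_rTensor,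
            LinearMap.rTensor_comp_lTensor]
        · intro s t hs ht
          simp only [map_add, hs, ht] }

theorem assoc_tmul (X Y : Bimod A) {N : ModuleCat.{u} A} (x : X.left) (y : Y.left) (n : N) :
    assoc X Y N ((X.prod Y).tmul (X.tmul x y) n) = X.tmul x (Y.tmul y n) := rfl

/-- `A` as a bimodule over itself. -/
def unit (A : Type u) [CommRing A] : Bimod A where
  left := ModuleCat.of A A
  act := Module.toModuleEnd A A

/-- The unit isomorphism `N → A ⊗_A N`, as a map: `n ↦ 1 ⊗ n`. -/
def toUnitTensor (N : ModuleCat.{u} A) : N ⟶ (unit A).tensor N :=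
  @ModuleCat.ofHom A _ N ((unit A).tensor N) _ _ _ _
    { toFun := fun n => (unit A).tmul (1 : A) n
      map_add' := fun m n => TensorProduct.tmul_add (show (unit A).Right from (1 : A)) m n
      map_smul' := fun a n =>
        (TensorProduct.smul_tmul a (show (unit A).Right from (1 : A)) n).symm }

/-- The `L`-completion `L₀ X` of a bimodule (with respect to the left action), with the right
action that it has by functoriality. -/
def complete (I : Ideal A) (X : Bimod A) : Bimod A where
  left := (L₀ I).obj X.left
  act :=
    { toFun := fun a => ((L₀ I).map (ModuleCat.ofHom (X.act a))).hom
      map_one' := by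
        rw [map_one]
        exact congrArg ModuleCat.Hom.hom ((L₀ I).map_id X.left)
      map_mul' := fun a b => by
        rw [map_mul]
        exact congrArg ModuleCat.Hom.hom
          ((L₀ I).map_comp (ModuleCat.ofHom (X.act b)) (ModuleCat.ofHom (X.act a)))
      map_zero' := by
        rw [map_zero]
        exact congrArg ModuleCat.Hom.hom ((L₀ I).map_zero X.left X.left)
      map_add' := fun a b => by
        rw [map_add]
        exact congrArg ModuleCat.Hom.hom
          ((L₀ I).map_add (f := ModuleCat.ofHom (X.act a)) (g := ModuleCat.ofHom (X.act b))) }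

/-- `L₀ f`, as a morphism of bimodules. -/
def completeMap (I : Ideal A) {X Y : Bimod A} (f : X ⟶ Y) : X.complete I ⟶ Y.complete I where
  hom := (L₀ I).map (Hom.hom f)
  comm a x := by
    have h : ModuleCat.ofHom (X.act a) ≫ Hom.hom f = Hom.hom f ≫ ModuleCat.ofHom (Y.act a) := by
      apply ModuleCat.hom_ext
      apply LinearMap.ext
      exact Hom.comm f a
    have h' := congrArg (L₀ I).map h
    rw [Functor.map_comp, Functor.map_comp] at h'
    exact ConcreteCategory.congr_hom h' x

/-- `η : X → L₀ X`, as a morphism of bimodules. -/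
def toComplete (I : Ideal A) (X : Bimod A) : X ⟶ X.complete I where
  hom := (η I).app X.left
  comm a x := ConcreteCategory.congr_hom ((η I).naturality (ModuleCat.ofHom (X.act a))) x

/-- The completed tensor product `X ⊠_A N = L₀ (X ⊗_A N)`. -/
def box (I : Ideal A) (X : Bimod A) (N : ModuleCat.{u} A) : ModuleCat.{u} A :=
  (L₀ I).obj (X.tensor N)

/-- The map `f ⊠ g : X ⊠_A N → Y ⊠_A N'`. -/
def boxMap (I : Ideal A) {X Y : Bimod A} {N N' : ModuleCat.{u} A} (f : X ⟶ Y) (g : N ⟶ N') :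
    X.box I N ⟶ Y.box I N' :=
  (L₀ I).map (tensorMap f g)

/-- The unit isomorphism `N → A^ ⊠ N = L₀ (L₀ A ⊗_A N)` (for `L`-complete `N`), as a map:
`n ↦ η (η 1 ⊗ n)`. -/
def toUnitBox (I : Ideal A) (N : ModuleCat.{u} A) :
    N ⟶ ((unit A).complete I).box I N :=
  toUnitTensor N ≫ tensorMap (toComplete I (unit A)) (𝟙 N) ≫
    (η I).app (((unit A).complete I).tensor N)

end Bimod

/-! ### Hopf algebroids and their comodules -/

section HopfAlgebroids

/-- The ring `B`, regarded as an `A`-algebra through `f : A → B`. -/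
def Via {A B : Type u} [CommRing A] [CommRing B] (_ : A →+* B) : Type u := B

instance {A B : Type u} [CommRing A] [CommRing B] (f : A →+* B) : CommRing (Via f) :=
  inferInstanceAs (CommRing B)

instance {A B : Type u} [CommRing A] [CommRing B] (f : A →+* B) : Algebra A (Via f) :=
  RingHom.toAlgebra (S := Via f) f

/-- For `r, l : A → R` and ring homomorphisms `f, g : R → B` with `f ∘ r = g ∘ l`, the ring
homomorphism `R ⊗_A R → B`, `x ⊗ y ↦ f x * g y`, where `A` acts on the left factor through `r` and
on the right factor through `l`. -/
def pair {A R B : Type u} [CommRing A] [CommRing R] [CommRing B] (r l : A →+* R) (f g : R →+* B)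
    (h : f.comp r = g.comp l) : Via r ⊗[A] Via l →+* B :=
  letI : Algebra A B := (f.comp r).toAlgebra
  (Algebra.TensorProduct.lift (S := A) (R := A)
    ({ (show Via r →+* B from f) with commutes' := fun _ => rfl } : Via r →ₐ[A] B)
    ({ (show Via l →+* B from g) with
        commutes' := fun a => (RingHom.congr_fun h a).symm } : Via l →ₐ[A] B)
    (fun _ _ => Commute.all _ _)).toRingHom

theorem pair_tmul {A R B : Type u} [CommRing A] [CommRing R] [CommRing B] (r l : A →+* R)
    (f g : R →+* B) (h : f.comp r = g.comp l) (x y : R) :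
    pair r l f g h ((show Via r from x) ⊗ₜ[A] (show Via l from y)) = f x * g y := rfl

/-- A Hopf algebroid `(A, Ψ)`: a cogroupoid object in commutative rings. Here `Ψ ⊗_A Ψ` is formed
with the right unit on the left factor and the left unit on the right factor. -/
structure HopfAlgebroid (A Ψ : Type u) [CommRing A] [CommRing Ψ] where
  /-- the left unit -/
  ηL : A →+* Ψ
  /-- the right unit -/
  ηR : A →+* Ψ
  /-- the diagonal (composition) -/
  Δ : Ψ →+* Via ηR ⊗[A] Via ηL
  /-- the counit (identity) -/
  ε : Ψ →+* A
  /-- the conjugation (inverse) -/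
  c : Ψ →+* Ψ
  ε_ηL : ε.comp ηL = RingHom.id A
  ε_ηR : ε.comp ηR = RingHom.id A
  Δ_ηL : ∀ a, Δ (ηL a) = (show Via ηR from ηL a) ⊗ₜ[A] 1
  Δ_ηR : ∀ a, Δ (ηR a) = 1 ⊗ₜ[A] (show Via ηL from ηR a)
  /-- `(ε ⊗ 1) Δ = 1` -/
  counit_left : (pair ηR ηL (ηL.comp ε) (RingHom.id Ψ)
    (by rw [RingHom.comp_assoc, ε_ηR]; rfl)).comp Δ = RingHom.id Ψ
  /-- `(1 ⊗ ε) Δ = 1` -/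
  counit_right : (pair ηR ηL (RingHom.id Ψ) (ηR.comp ε)
    (by rw [RingHom.comp_assoc, ε_ηL]; rfl)).comp Δ = RingHom.id Ψ
  /-- `(Δ ⊗ 1) Δ = (1 ⊗ Δ) Δ`, tested on an arbitrary ring `B` with three maps from `Ψ` that
  together amount to a ring homomorphism `Ψ ⊗_A Ψ ⊗_A Ψ → B`: the composition of morphisms that
  `Δ` induces on ring homomorphisms `Ψ → B` is associative -/
  coassoc : ∀ {B : Type u} [CommRing B] (f g h : Ψ →+* B)
    (hfg : f.comp ηR = g.comp ηL) (hgh : g.comp ηR = h.comp ηL)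
    (h₁ : ((pair ηR ηL f g hfg).comp Δ).comp ηR = h.comp ηL)
    (h₂ : f.comp ηR = ((pair ηR ηL g h hgh).comp Δ).comp ηL),
    (pair ηR ηL ((pair ηR ηL f g hfg).comp Δ) h h₁).comp Δ =
      (pair ηR ηL f ((pair ηR ηL g h hgh).comp Δ) h₂).comp Δ
  c_ηL : c.comp ηL = ηR
  c_ηR : c.comp ηR = ηL
  c_c : c.comp c = RingHom.id Ψ
  /-- `(c · 1) Δ = ηR ε` -/
  c_left : (pair ηR ηL c (RingHom.id Ψ) (by rw [c_ηR]; rfl)).comp Δ = ηR.comp ε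
  /-- `(1 · c) Δ = ηL ε` -/
  c_right : (pair ηR ηL (RingHom.id Ψ) c (by rw [c_ηL]; rfl)).comp Δ = ηL.comp ε

namespace HopfAlgebroid

variable {A Ψ : Type u} [CommRing A] [CommRing Ψ] (H : HopfAlgebroid A Ψ)

/-- `Ψ` as an `A`-bimodule: left action through the left unit, right action through the right
unit. -/
def bimod : Bimod A where
  left := ModuleCat.of A (Via H.ηL)
  act :=
    { toFun := fun a => LinearMap.mulLeft A (show Via H.ηL from H.ηR a)
      map_one' := by rw [map_one]; exact LinearMap.mulLeft_one _ _
      map_mul' := fun a b => by rw [map_mul]; exact LinearMap.mulLeft_mul _ _ _ _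
      map_zero' := by rw [map_zero]; exact LinearMap.mulLeft_zero_eq_zero _ _
      map_add' := fun a b => by rw [map_add]; exact (LinearMap.mul A (Via H.ηL)).map_add _ _ }

/-- The identity map from `Ψ`, as a module through the right unit, to the right module underlying
`bimod`. -/
def toRight : Via H.ηR →ₗ[A] H.bimod.Right where
  toFun x := x
  map_add' _ _ := rfl
  map_smul' _ _ := rfl

/-- The identity map from the ring `Ψ ⊗_A Ψ` to the bimodule `Ψ ⊗_A Ψ`. -/
def toProd : Via H.ηR ⊗[A] Via H.ηL →+ (H.bimod.prod H.bimod).left :=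
  (TensorProduct.map H.toRight (LinearMap.id (R := A) (M := Via H.ηL))).toAddMonoidHom

theorem toProd_tmul (x y : Ψ) :
    H.toProd ((show Via H.ηR from x) ⊗ₜ[A] (show Via H.ηL from y)) =
      H.bimod.tmul (show H.bimod.left from x) (show H.bimod.left from y) := rfl

theorem toProd_mul_left (a : A) (t : Via H.ηR ⊗[A] Via H.ηL) :
    H.toProd ((show Via H.ηR from H.ηL a) ⊗ₜ[A] 1 * t) = a • H.toProd t := by
  induction t using TensorProduct.induction_on with
  | zero => rw [mul_zero, map_zero, smul_zero]
  | tmul x y =>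
    rw [Algebra.TensorProduct.tmul_mul_tmul, one_mul]
    rfl
  | add s t hs ht => rw [mul_add, map_add, map_add, smul_add, hs, ht]

theorem toProd_mul_right (a : A) (t : Via H.ηR ⊗[A] Via H.ηL) :
    H.toProd (1 ⊗ₜ[A] (show Via H.ηL from H.ηR a) * t) =
      (H.bimod.prod H.bimod).act a (H.toProd t) := by
  induction t using TensorProduct.induction_on with
  | zero => rw [mul_zero, map_zero, map_zero]
  | tmul x y =>
    rw [Algebra.TensorProduct.tmul_mul_tmul, one_mul]
    rfl
  | add s t hs ht => rw [mul_add, map_add, map_add, map_add, hs, ht]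

/-- The diagonal `Δ`, as a morphism of bimodules `Ψ → Ψ ⊗_A Ψ`. -/
def comul : H.bimod ⟶ H.bimod.prod H.bimod where
  hom := @ModuleCat.ofHom A _ H.bimod.left (H.bimod.prod H.bimod).left _ _ _ _
    { toFun := fun x => H.toProd (H.Δ x)
      map_add' := fun x y =>
        (congrArg H.toProd (map_add H.Δ x y)).trans (map_add H.toProd _ _)
      map_smul' := fun a x => by
        have h : H.Δ (H.ηL a * (show Ψ from x)) =
            (show Via H.ηR from H.ηL a) ⊗ₜ[A] 1 * H.Δ x := by
          rw [map_mul, H.Δ_ηL]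
        exact (congrArg H.toProd h).trans (H.toProd_mul_left a _) }
  comm a x := by
    have h : H.Δ (H.ηR a * (show Ψ from x)) =
        1 ⊗ₜ[A] (show Via H.ηL from H.ηR a) * H.Δ x := by
      rw [map_mul, H.Δ_ηR]
    exact (congrArg H.toProd h).trans (H.toProd_mul_right a _)

/-- The counit `ε`, as a morphism of bimodules `Ψ → A`. -/
def counit : H.bimod ⟶ Bimod.unit A where
  hom := @ModuleCat.ofHom A _ H.bimod.left (Bimod.unit A).left _ _ _ _
    { toFun := fun x => H.ε x
      map_add' := fun x y => map_add H.ε (show Ψ from x) (show Ψ from y)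
      map_smul' := fun a x => by
        have h : H.ε (H.ηL a * (show Ψ from x)) = a * H.ε x := by
          rw [map_mul]
          exact congrArg (· * H.ε x) (RingHom.congr_fun H.ε_ηL a)
        exact h }
  comm a x := by
    have h : H.ε (H.ηR a * (show Ψ from x)) = a * H.ε x := by
      rw [map_mul]
      exact congrArg (· * H.ε x) (RingHom.congr_fun H.ε_ηR a)
    exact h

/-- `ρ : M → Ψ ⊗_A M` makes the `A`-module `M` a (left) `Ψ`-comodule: it is counital,
`(ε ⊗ 1) ρ = 1`, and coassociative, `(Δ ⊗ 1) ρ = (1 ⊗ ρ) ρ`. -/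
structure IsCoaction {M : ModuleCat.{u} A} (ρ : M ⟶ H.bimod.tensor M) : Prop where
  counit : ρ ≫ Bimod.tensorMap H.counit (𝟙 M) = Bimod.toUnitTensor M
  coassoc : ρ ≫ Bimod.tensorMap H.comul (𝟙 M) ≫ Bimod.assoc H.bimod H.bimod M =
    ρ ≫ Bimod.tensorMap (𝟙 H.bimod) ρ

/-! ### The completed Hopf algebroid and its `L`-complete comodules -/

/-- `Ψ^ = L₀ Ψ`, as a bimodule. -/
def completed (I : Ideal A) : Bimod A := H.bimod.complete I

/-- The map `Ψ → Ψ^`. -/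
def toCompleted (I : Ideal A) : H.bimod ⟶ H.completed I := H.bimod.toComplete I

/-- The induced diagonal `Δ^ : Ψ^ → Ψ^ ⊠_A Ψ^ = L₀ (Ψ^ ⊗_A Ψ^)`, obtained by applying `L₀` to
`Ψ → Ψ ⊗_A Ψ → Ψ^ ⊗_A Ψ^`. -/
def comulHat (I : Ideal A) :
    H.completed I ⟶ ((H.completed I).prod (H.completed I)).complete I :=
  Bimod.completeMap I (H.comul ≫ Bimod.prodMap (H.toCompleted I) (H.toCompleted I))

/-- The induced counit `ε^ : Ψ^ → A^ = L₀ A`. -/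
def counitHat (I : Ideal A) : H.completed I ⟶ (Bimod.unit A).complete I :=
  Bimod.completeMap I H.counit

/-- The unbracketed triple product `Ψ^ ⊠ Ψ^ ⊠ N = L₀ (Ψ^ ⊗ Ψ^ ⊗ N)`. -/
def triple (I : Ideal A) (N : ModuleCat.{u} A) : ModuleCat.{u} A :=
  ((H.completed I).prod (H.completed I)).box I N

/-- The canonical isomorphism `Ψ^ ⊠ Ψ^ ⊠ N → Ψ^ ⊠ (Ψ^ ⊠ N)`. -/
def tripleToRight (I : Ideal A) (N : ModuleCat.{u} A) :
    H.triple I N ⟶ (H.completed I).box I ((H.completed I).box I N) :=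
  (L₀ I).map (Bimod.assoc (H.completed I) (H.completed I) N ≫
    Bimod.tensorMap (𝟙 _) ((η I).app ((H.completed I).tensor N)))

/-- The canonical isomorphism `Ψ^ ⊠ Ψ^ ⊠ N → (Ψ^ ⊠ Ψ^) ⊠ N`. -/
def tripleToLeft (I : Ideal A) (N : ModuleCat.{u} A) :
    H.triple I N ⟶ (((H.completed I).prod (H.completed I)).complete I).box I N :=
  Bimod.boxMap I (Bimod.toComplete I _) (𝟙 N)

/-- An `L`-complete (left) `Ψ^`-comodule: an `L`-complete module `N` with a linear map
`N → Ψ^ ⊠ N` that is counital and coassociative. -/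
structure LCompleteComodule (I : Ideal A) where
  carrier : ModuleCat.{u} A
  complete : IsLComplete I carrier
  coact : carrier ⟶ (H.completed I).box I carrier
  /-- `(ε^ ⊠ 1) ψ = 1`, up to the unit isomorphism -/
  counit : coact ≫ Bimod.boxMap I (H.counitHat I) (𝟙 carrier) = Bimod.toUnitBox I carrier
  /-- `(1 ⊠ ψ) ψ` and `(Δ^ ⊠ 1) ψ` agree up to the associativity isomorphism
  `Ψ^ ⊠ (Ψ^ ⊠ N) ≅ Ψ^ ⊠ Ψ^ ⊠ N ≅ (Ψ^ ⊠ Ψ^) ⊠ N`: they come from one and the same map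
  `N → Ψ^ ⊠ Ψ^ ⊠ N` -/
  coassoc : ∃ ψ₂ : carrier ⟶ H.triple I carrier,
    ψ₂ ≫ H.tripleToRight I carrier = coact ≫ Bimod.boxMap I (𝟙 _) coact ∧
    ψ₂ ≫ H.tripleToLeft I carrier = coact ≫ Bimod.boxMap I (H.comulHat I) (𝟙 carrier)

namespace LCompleteComodule

variable {H} {I : Ideal A} (N : H.LCompleteComodule I)

/-- `j : Ψ ⊗ N → Ψ ⊠ N ≅ Ψ^ ⊠ N`. -/
def j : H.bimod.tensor N.carrier ⟶ (H.completed I).box I N.carrier :=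
  (η I).app (H.bimod.tensor N.carrier) ≫ Bimod.boxMap I (H.toCompleted I) (𝟙 N.carrier)

/-- `j' : Ψ ⊗ Ψ ⊠ N → Ψ ⊠ Ψ ⊠ N ≅ Ψ^ ⊠ Ψ^ ⊠ N`. -/
def j' : H.bimod.tensor (H.bimod.box I N.carrier) ⟶
    (H.completed I).box I ((H.completed I).box I N.carrier) :=
  (η I).app (H.bimod.tensor (H.bimod.box I N.carrier)) ≫
    Bimod.boxMap I (H.toCompleted I) (Bimod.boxMap I (H.toCompleted I) (𝟙 N.carrier))

/-- `ν N`: the pullback, in `A`-modules, of the coaction `N → Ψ^ ⊠ N` and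
`j : Ψ ⊗ N → Ψ^ ⊠ N`. -/
def ν : ModuleCat.{u} A := Limits.pullback N.coact N.j

/-- The projection `i : ν N → N`. -/
def i : N.ν ⟶ N.carrier := Limits.pullback.fst N.coact N.j

/-- The projection `p : ν N → Ψ ⊗ N`. -/
def p : N.ν ⟶ H.bimod.tensor N.carrier := Limits.pullback.snd N.coact N.j

end LCompleteComodule

end HopfAlgebroid

end HopfAlgebroids

end LComp

end

/-! Write `ψ` for the coaction of `N`. The pullback `ν N` is the kernel of `N → Ψ^ ⊠ N → coker j`,
and `Ψ ⊗ -` is exact (flatness passes from the left to the right action by conjugation). So `Ψ ⊗ ν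
N` is the kernel of `Ψ ⊗ N → Ψ ⊗ coker j`, and `p` lifts uniquely to `Ψ ⊗ ν N` once it is known to
land there. That follows from `(1 ⊗ ψ) p = (1 ⊗ j) (Δ ⊗ 1) p` (`p_coassoc`), whose right side dies
in `Ψ ⊗ coker j`. The comodule axioms for the lift are then checked after composing with injections.

The identity `p_coassoc` is the coassociativity of `ψ` restricted to `ν N`. Extracting it needs two
comparisons between `X` and `L₀ X`. Injectivity: `X ⊠ N → L₀ X ⊠ N` is injective because `η` on `X ⊗
N` factors through `L₀ X ⊗ N` and `L₀ η` is injective (`L₀_map_ηMap_injective`). For projective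
modules `L₀` is adic completion and the multiplication `C^I C^I → C^I` gives a retraction; the
general case follows by right exactness of `L₀`. Surjectivity: the same map is surjective because
`η` is surjective modulo the finitely generated ideal `I`, and `L₀` turns such maps into
surjections. Hence injectivity of `j'` passes to `Ψ ⊗ (Ψ^ ⊠ N) → Ψ^ ⊠ (Ψ^ ⊠ N)`. -/

noncomputable section

namespace LComp

/-! ### The zeroth left derived functor -/

section Derived

universe v w v' w'

variable {C : Type w} [Category.{v} C] {D : Type w'} [Category.{v'} D]
  [Abelian C] [HasProjectiveResolutions C] [Abelian D]

/-- The augmentation `P₀ → X` of a projective resolution. -/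
def augmentation {X : C} (P : ProjectiveResolution X) : P.complex.X 0 ⟶ X := P.π.f 0

instance {X : C} (P : ProjectiveResolution X) : Epi (augmentation P) :=
  inferInstanceAs (Epi (P.π.f 0))

/-- `(L₀F) X` as the degree zero homology of `F P`. -/
def derivedIsoHomology (F : C ⥤ D) [F.Additive] {X : C} (P : ProjectiveResolution X) :
    (F.leftDerived 0).obj X ≅
      ((F.mapHomologicalComplex (ComplexShape.down ℕ)).obj P.complex).homology 0 :=
  P.isoLeftDerivedObj F 0

/-- `(L₀F) X` as the opcycles of `F P` in degree zero. -/
def derivedIsoOpcycles (F : C ⥤ D) [F.Additive] {X : C} (P : ProjectiveResolution X) :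
    (F.leftDerived 0).obj X ≅
      ((F.mapHomologicalComplex (ComplexShape.down ℕ)).obj P.complex).opcycles 0 :=
  derivedIsoHomology F P ≪≫ ChainComplex.isoHomologyι₀ _

/-- Opcycles are used in place of homology because `F P₀` maps onto them directly, so identities of
maps out of `L₀F` can be tested on `F P₀`. -/
theorem derivedIsoOpcycles_inv_naturality (F : C ⥤ D) [F.Additive] {X Y : C} (f : X ⟶ Y)
    (P : ProjectiveResolution X) (Q : ProjectiveResolution Y) (φ : P.complex ⟶ Q.complex)
    (comm : φ.f 0 ≫ augmentation Q = augmentation P ≫ f) :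
    (derivedIsoOpcycles F P).inv ≫ (F.leftDerived 0).map f =
      HomologicalComplex.opcyclesMap ((F.mapHomologicalComplex _).map φ) 0 ≫
        (derivedIsoOpcycles F Q).inv := by
  have h : (derivedIsoHomology F P).inv ≫ (F.leftDerived 0).map f =
      HomologicalComplex.homologyMap ((F.mapHomologicalComplex _).map φ) 0 ≫
        (derivedIsoHomology F Q).inv := P.isoLeftDerivedObj_inv_naturality f Q φ comm F 0
  simp only [derivedIsoOpcycles, Iso.trans_inv, Category.assoc, h]
  exact ChainComplex.isoHomologyι₀_inv_naturality_assoc _ _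

theorem derivedIsoOpcycles_inv_leftDerived (F G : C ⥤ D) [F.Additive] [G.Additive] (α : F ⟶ G)
    {X : C} (P : ProjectiveResolution X) :
    (derivedIsoOpcycles F P).inv ≫ (NatTrans.leftDerived α 0).app X =
      HomologicalComplex.opcyclesMap ((NatTrans.mapHomologicalComplex α _).app P.complex) 0 ≫
        (derivedIsoOpcycles G P).inv := by
  have h : (NatTrans.leftDerived α 0).app X = (derivedIsoHomology F P).hom ≫
      HomologicalComplex.homologyMap ((NatTrans.mapHomologicalComplex α _).app P.complex) 0 ≫
        (derivedIsoHomology G P).inv := P.leftDerived_app_eq α 0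
  simp only [derivedIsoOpcycles, Iso.trans_inv, Category.assoc, h, Iso.inv_hom_id_assoc]
  exact ChainComplex.isoHomologyι₀_inv_naturality_assoc _ _

/-- The projection from `F P₀`, as the degree zero object of the complex `F P`, to `(L₀F) X`. -/
def resolutionProjAux (F : C ⥤ D) [F.Additive] {X : C} (P : ProjectiveResolution X) :
    ((F.mapHomologicalComplex (ComplexShape.down ℕ)).obj P.complex).X 0 ⟶
      (F.leftDerived 0).obj X :=
  ((F.mapHomologicalComplex (ComplexShape.down ℕ)).obj P.complex).pOpcycles 0 ≫
    (derivedIsoOpcycles F P).inv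

/-- The projection `F P₀ → (L₀F) X` attached to a projective resolution `P` of `X`. -/
def resolutionProj (F : C ⥤ D) [F.Additive] {X : C} (P : ProjectiveResolution X) :
    F.obj (P.complex.X 0) ⟶ (F.leftDerived 0).obj X :=
  resolutionProjAux F P

instance (F : C ⥤ D) [F.Additive] {X : C} (P : ProjectiveResolution X) :
    Epi (resolutionProjAux F P) :=
  epi_comp _ _

instance (F : C ⥤ D) [F.Additive] {X : C} (P : ProjectiveResolution X) :
    Epi (resolutionProj F P) :=
  inferInstanceAs (Epi (resolutionProjAux F P))

theorem resolutionProj_naturality (F : C ⥤ D) [F.Additive] {X Y : C} (f : X ⟶ Y)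
    (P : ProjectiveResolution X) (Q : ProjectiveResolution Y) (φ : P.complex ⟶ Q.complex)
    (comm : φ.f 0 ≫ augmentation Q = augmentation P ≫ f) :
    resolutionProj F P ≫ (F.leftDerived 0).map f = F.map (φ.f 0) ≫ resolutionProj F Q := by
  change resolutionProjAux F P ≫ (F.leftDerived 0).map f =
    ((F.mapHomologicalComplex _).map φ).f 0 ≫ resolutionProjAux F Q
  unfold resolutionProjAux
  rw [Category.assoc, derivedIsoOpcycles_inv_naturality F f P Q φ comm,
    HomologicalComplex.p_opcyclesMap_assoc]

theorem resolutionProj_fromLeftDerivedZero (F : C ⥤ D) [F.Additive] {X : C}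
    (P : ProjectiveResolution X) :
    resolutionProj F P ≫ F.fromLeftDerivedZero.app X = F.map (augmentation P) := by
  have h : F.fromLeftDerivedZero.app X =
      (derivedIsoOpcycles F P).hom ≫ P.fromLeftDerivedZero' F := by
    rw [P.fromLeftDerivedZero_eq F, derivedIsoOpcycles, Iso.trans_hom, Category.assoc]
    rfl
  change resolutionProjAux F P ≫ F.fromLeftDerivedZero.app X = F.map (augmentation P)
  rw [h, resolutionProjAux, Category.assoc, Iso.inv_hom_id_assoc]
  exact HomologicalComplex.p_descOpcycles _ _ _ _ _

theorem resolutionProj_leftDerived (F G : C ⥤ D) [F.Additive] [G.Additive] (α : F ⟶ G) {X : C}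
    (P : ProjectiveResolution X) :
    resolutionProj F P ≫ (NatTrans.leftDerived α 0).app X =
      α.app (P.complex.X 0) ≫ resolutionProj G P := by
  change resolutionProjAux F P ≫ (NatTrans.leftDerived α 0).app X =
    ((NatTrans.mapHomologicalComplex α _).app P.complex).f 0 ≫ resolutionProjAux G P
  unfold resolutionProjAux
  rw [Category.assoc, derivedIsoOpcycles_inv_leftDerived, HomologicalComplex.p_opcyclesMap_assoc]

theorem leftDerived_fromLeftDerivedZero (F G : C ⥤ D) [F.Additive] [G.Additive] (α : F ⟶ G)
    (X : C) :
    (NatTrans.leftDerived α 0).app X ≫ G.fromLeftDerivedZero.app X =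
      F.fromLeftDerivedZero.app X ≫ α.app X := by
  rw [← cancel_epi (resolutionProj F (projectiveResolution X)), ← Category.assoc,
    resolutionProj_leftDerived, Category.assoc, resolutionProj_fromLeftDerivedZero,
    ← Category.assoc, resolutionProj_fromLeftDerivedZero, α.naturality]

/-- `P₀` is projective, hence its own resolution concentrated in degree zero. The chain map to `P`
that is the identity in degree zero lies over the augmentation, and naturality of the projections
applies to it. -/
theorem fromLeftDerivedZero_resolutionProj (F : C ⥤ D) [F.Additive] {X : C}
    (P : ProjectiveResolution X) :
    F.fromLeftDerivedZero.app (P.complex.X 0) ≫ resolutionProj F P =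
      (F.leftDerived 0).map (augmentation P) := by
  have key (S : ProjectiveResolution (P.complex.X 0)) (φ : S.complex ⟶ P.complex)
      (hφ : φ.f 0 = augmentation S) : F.fromLeftDerivedZero.app (P.complex.X 0) ≫
        resolutionProj F P = (F.leftDerived 0).map (augmentation P) := by
    rw [← cancel_epi (resolutionProj F S), resolutionProj_naturality F (augmentation P) S P φ
      (by rw [hφ]), ← Category.assoc, resolutionProj_fromLeftDerivedZero, hφ]
  exact key (ProjectiveResolution.self (P.complex.X 0))
    ((ChainComplex.fromSingle₀Equiv P.complex (P.complex.X 0)).symm (𝟙 _))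
    (by rw [ChainComplex.fromSingle₀Equiv_symm_apply_f_zero]; rfl)

/-- The opcycles in degree zero are the cokernel of the differential from degree one. -/
theorem resolutionProj_exact (F : C ⥤ D) [F.Additive] {X : C} (P : ProjectiveResolution X) :
    ∃ w, (ShortComplex.mk (F.map (P.complex.d 1 0)) (resolutionProj F P) w).Exact := by
  let K := (F.mapHomologicalComplex (ComplexShape.down ℕ)).obj P.complex
  have hw : K.d 1 0 ≫ resolutionProjAux F P = 0 := by
    rw [resolutionProjAux, HomologicalComplex.d_pOpcycles_assoc, Limits.zero_comp]
  refine ⟨hw, ?_⟩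
  have h : (ShortComplex.mk (K.d 1 0) (K.pOpcycles 0) (by simp)).Exact :=
    ShortComplex.exact_of_g_is_cokernel _ (K.opcyclesIsCokernel 1 0 (by simp))
  exact (ShortComplex.exact_iff_of_iso (ShortComplex.isoMk (Iso.refl _) (Iso.refl _)
    (derivedIsoOpcycles F P).symm (by simp) (by simp [resolutionProjAux, K]) :
      ShortComplex.mk (K.d 1 0) (K.pOpcycles 0) (by simp) ≅
      ShortComplex.mk (K.d 1 0) (resolutionProjAux F P) hw)).1 h

end Derived

/-! ### Right exactness of `L`-completion -/

section Completion

variable {A : Type u} [CommRing A] (I : Ideal A)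

/-- The natural map `L₀ M → C^I(M)`. -/
def toAdicCompletion : L₀ I ⟶ adicFunctor I := (adicFunctor I).fromLeftDerivedZero

instance (M : ModuleCat.{u} A) [Projective M] : IsIso ((toAdicCompletion I).app M) :=
  inferInstanceAs (IsIso ((adicFunctor I).fromLeftDerivedZero.app M))

/-- The natural map `M → L₀ M`. -/
def ηMap (M : ModuleCat.{u} A) : M ⟶ (L₀ I).obj M := (η I).app M

theorem ηMap_naturality {M N : ModuleCat.{u} A} (f : M ⟶ N) :
    f ≫ ηMap I N = ηMap I M ≫ (L₀ I).map f :=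
  (η I).naturality f

/-- The natural map `M → C^I(M)`. -/
def toAdicMap (M : ModuleCat.{u} A) : M ⟶ (adicFunctor I).obj M := (toAdic I).app M

/-- `η` is the derived form of `M → C^I(M)`, and the comparison of derived with underived functors
is natural in the functor. -/
theorem ηMap_toAdicCompletion (M : ModuleCat.{u} A) :
    ηMap I M ≫ (toAdicCompletion I).app M = toAdicMap I M := by
  have h := leftDerived_fromLeftDerivedZero _ _ (toAdic I) M
  have h' : (𝟭 (ModuleCat.{u} A)).leftDerivedZeroIsoSelf.inv.app M ≫
      (NatTrans.leftDerived (toAdic I) 0).app M ≫ (adicFunctor I).fromLeftDerivedZero.app M =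
      (toAdic I).app M := by
    rw [h]
    exact Functor.leftDerivedZeroIsoSelf_inv_hom_id_app_assoc _ _ _
  exact h'

/-- The projection `C^I(P₀) → L₀ M` attached to a projective resolution of `M`. -/
def adicProj {M : ModuleCat.{u} A} (P : ProjectiveResolution M) :
    (adicFunctor I).obj (P.complex.X 0) ⟶ (L₀ I).obj M :=
  resolutionProj (adicFunctor I) P

instance {M : ModuleCat.{u} A} (P : ProjectiveResolution M) : Epi (adicProj I P) :=
  inferInstanceAs (Epi (resolutionProj (adicFunctor I) P))

theorem toAdicCompletion_adicProj {M : ModuleCat.{u} A} (P : ProjectiveResolution M) :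
    (toAdicCompletion I).app (P.complex.X 0) ≫ adicProj I P = (L₀ I).map (augmentation P) :=
  fromLeftDerivedZero_resolutionProj _ P

theorem adicProj_exact {M : ModuleCat.{u} A} (P : ProjectiveResolution M) :
    Function.Exact ((adicFunctor I).map (P.complex.d 1 0)) (adicProj I P) := by
  obtain ⟨w, hw⟩ := resolutionProj_exact (adicFunctor I) P
  exact (ShortComplex.ShortExact.moduleCat_exact_iff_function_exact _).1 hw

theorem adicProj_surjective {M : ModuleCat.{u} A} (P : ProjectiveResolution M) :
    Function.Surjective (adicProj I P) :=
  (ModuleCat.epi_iff_surjective _).1 inferInstance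

theorem toAdicCompletion_bijective (M : ModuleCat.{u} A) [Projective M] :
    Function.Bijective ((toAdicCompletion I).app M) :=
  ConcreteCategory.bijective_of_isIso _

theorem L₀_augmentation_surjective {M : ModuleCat.{u} A} (P : ProjectiveResolution M) :
    Function.Surjective ((L₀ I).map (augmentation P)) := by
  have := P.projective 0
  rw [← toAdicCompletion_adicProj]
  exact (adicProj_surjective I P).comp (toAdicCompletion_bijective I _).surjective

/-- `P₁` and `P₀` are projective, so on them `L₀` is `C^I`; exactness is transported from
`adicProj_exact`. -/
theorem L₀_augmentation_exact {M : ModuleCat.{u} A} (P : ProjectiveResolution M) :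
    Function.Exact ((L₀ I).map (P.complex.d 1 0)) ((L₀ I).map (augmentation P)) := by
  have := P.projective 0
  have := P.projective 1
  have hn := (toAdicCompletion I).naturality (P.complex.d 1 0)
  intro y
  rw [← toAdicCompletion_adicProj, ModuleCat.comp_apply, adicProj_exact I P _]
  constructor
  · rintro ⟨x, hx⟩
    obtain ⟨x, rfl⟩ := (toAdicCompletion_bijective I _).surjective x
    refine ⟨x, (toAdicCompletion_bijective I _).injective ?_⟩
    rw [← hx, ← ModuleCat.comp_apply, ← ModuleCat.comp_apply, hn]
  · rintro ⟨x, rfl⟩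
    exact ⟨(toAdicCompletion I).app _ x, by
      rw [← ModuleCat.comp_apply, ← ModuleCat.comp_apply, hn]⟩

/-- `L`-completion preserves surjections. -/
theorem L₀_map_surjective {M N : ModuleCat.{u} A} (f : M ⟶ N) (hf : Function.Surjective f) :
    Function.Surjective ((L₀ I).map f) := by
  let P := projectiveResolution N
  have := P.projective 0
  have := (ModuleCat.epi_iff_surjective f).2 hf
  have h : (L₀ I).map (Projective.factorThru (augmentation P) f) ≫ (L₀ I).map f =
      (L₀ I).map (augmentation P) := by
    rw [← Functor.map_comp, Projective.factorThru_comp]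
  have hs := L₀_augmentation_surjective I P
  rw [← h] at hs
  exact Function.Surjective.of_comp hs

theorem exists_factor_of_exact {P K Q M : ModuleCat.{u} A} [Projective P] (a : K ⟶ Q) (b : Q ⟶ M)
    (h : Function.Exact a b) (f : P ⟶ Q) (hf : f ≫ b = 0) : ∃ g : P ⟶ K, g ≫ a = f := by
  let S := ShortComplex.mk a b (by ext x; exact h.apply_apply_eq_zero x)
  have hS : S.Exact := (ShortComplex.ShortExact.moduleCat_exact_iff_function_exact S).2 h
  exact ⟨hS.liftFromProjective f hf, hS.liftFromProjective_comp f hf⟩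

/-- `L`-completion is right exact at a projective presentation. -/
theorem L₀_exact_of_projective {K Q M : ModuleCat.{u} A} [Projective Q] (a : K ⟶ Q) (b : Q ⟶ M)
    (h : Function.Exact a b) (hb : Function.Surjective b) :
    Function.Exact ((L₀ I).map a) ((L₀ I).map b) := by
  have hab : a ≫ b = 0 := by ext x; exact h.apply_apply_eq_zero x
  intro y
  constructor
  · intro hy
    let P := projectiveResolution M
    have := P.projective 0
    have := P.projective 1
    have := (ModuleCat.epi_iff_surjective b).2 hb
    -- The two projective covers of `M` are compared by maps over `M`. Both `d ≫ t` and `1 - s ≫ t`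
    -- then land in the kernel of `b`, so they factor through `a`.
    let s : Q ⟶ P.complex.X 0 := Projective.factorThru b (augmentation P)
    let t : P.complex.X 0 ⟶ Q := Projective.factorThru (augmentation P) b
    have hs : s ≫ augmentation P = b := Projective.factorThru_comp _ _
    have ht : t ≫ b = augmentation P := Projective.factorThru_comp _ _
    have hd : P.complex.d 1 0 ≫ augmentation P = 0 := P.complex_d_comp_π_f_zero
    obtain ⟨g, hg⟩ := exists_factor_of_exact a b h (P.complex.d 1 0 ≫ t)
      (by rw [Category.assoc, ht, hd])
    obtain ⟨k, hk⟩ := exists_factor_of_exact a b h (𝟙 Q - s ≫ t)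
      (by rw [Preadditive.sub_comp, Category.assoc, ht, hs, Category.id_comp, sub_self])
    obtain ⟨w, hw⟩ := (L₀_augmentation_exact I P ((L₀ I).map s y)).1 (by
      rw [← ModuleCat.comp_apply, ← Functor.map_comp, hs, hy])
    -- Split `y` as `(1 - s ≫ t) y` plus `(s ≫ t) y`: the first part comes from `k`, the second from
    -- `g`.
    refine ⟨(L₀ I).map g w + (L₀ I).map k y, ?_⟩
    rw [map_add, ← ModuleCat.comp_apply, ← ModuleCat.comp_apply, ← Functor.map_comp,
      ← Functor.map_comp, hg, hk, Functor.map_comp, ModuleCat.comp_apply, hw, Functor.map_sub,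
      Functor.map_comp, CategoryTheory.Functor.map_id]
    simp
  · rintro ⟨x, rfl⟩
    rw [← ModuleCat.comp_apply, ← Functor.map_comp, hab, Functor.map_zero]
    rfl

/-- `L`-completion is right exact. -/
theorem L₀_exact {K L M : ModuleCat.{u} A} (f : K ⟶ L) (g : L ⟶ M)
    (h : Function.Exact f g) (hg : Function.Surjective g) :
    Function.Exact ((L₀ I).map f) ((L₀ I).map g) := by
  have hfg : f ≫ g = 0 := by ext x; exact h.apply_apply_eq_zero x
  intro y
  constructor
  · intro hy
    let F : ModuleCat.{u} A := Projective.over L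
    have : Projective F := inferInstanceAs (Projective (Projective.over L))
    let b : F ⟶ L := Projective.π L
    have hb : Function.Surjective b := (ModuleCat.epi_iff_surjective b).1 inferInstance
    -- `E` is the fibre product of `K` and `F` over `L`, so `E → F → M` is exact with `F` projective
    -- and the previous case applies.
    let E := ModuleCat.of A (LinearMap.eqLocus (f.hom ∘ₗ LinearMap.fst A K F)
      (b.hom ∘ₗ LinearMap.snd A K F))
    let e₁ : E ⟶ K := ModuleCat.ofHom (LinearMap.fst A K F ∘ₗ Submodule.subtype _)
    let e₂ : E ⟶ F :=
      ModuleCat.ofHom (LinearMap.snd A K F ∘ₗ Submodule.subtype _)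
    have he : e₁ ≫ f = e₂ ≫ b := by ext x; exact x.2
    obtain ⟨z, rfl⟩ := L₀_map_surjective I b hb y
    have hE : Function.Exact e₂ (b ≫ g) := by
      intro q
      constructor
      · intro hq
        obtain ⟨k, hk⟩ := (h (b q)).1 hq
        exact ⟨⟨(k, q), hk⟩, rfl⟩
      · rintro ⟨x, rfl⟩
        rw [← ModuleCat.comp_apply, ← Category.assoc, ← he, Category.assoc, hfg,
          Limits.comp_zero]
        rfl
    obtain ⟨w, rfl⟩ := (L₀_exact_of_projective I e₂ (b ≫ g) hE (hg.comp hb) z).1 (by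
      rw [Functor.map_comp, ModuleCat.comp_apply, hy])
    refine ⟨(L₀ I).map e₁ w, ?_⟩
    rw [← ModuleCat.comp_apply, ← ModuleCat.comp_apply, ← Functor.map_comp, ← Functor.map_comp, he]
  · rintro ⟨x, rfl⟩
    rw [← ModuleCat.comp_apply, ← Functor.map_comp, hfg, Functor.map_zero]
    rfl

/-! ### The unit of `L`-completion -/

/-- The map `C^I(C^I(M)) → C^I(M)`. -/
def adicMul (M : Type u) [AddCommGroup M] [Module A M] :
    AdicCompletion I (AdicCompletion I M) →ₗ[A] AdicCompletion I M :=
  AdicCompletion.lift I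
    -- Evaluation at level `n` kills `I ^ n • C^I(M)` for every ideal, so no finiteness of `I` is
    -- needed here.
    (fun n => (Submodule.liftQ _ (AdicCompletion.eval I M n)
      (AdicCompletion.pow_smul_top_le_ker_eval I n)) ∘ₗ
        AdicCompletion.eval I (AdicCompletion I M) n)
    (fun {m n} hle => by
      have h : AdicCompletion.transitionMap I M hle ∘ₗ
          (Submodule.liftQ _ (AdicCompletion.eval I M n)
            (AdicCompletion.pow_smul_top_le_ker_eval I n)) =
          (Submodule.liftQ _ (AdicCompletion.eval I M m)
            (AdicCompletion.pow_smul_top_le_ker_eval I m)) ∘ₗ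
          AdicCompletion.transitionMap I (AdicCompletion I M) hle := by
        apply Submodule.linearMap_qext
        ext x
        exact AdicCompletion.transitionMap_comp_eval_apply _ _ hle (AdicCompletion.mk I M x)
      rw [← LinearMap.comp_assoc, h, LinearMap.comp_assoc,
        AdicCompletion.transitionMap_comp_eval])

theorem adicMul_val_mk (M : Type u) [AddCommGroup M] [Module A M]
    (x : AdicCompletion.AdicCauchySequence I (AdicCompletion I M)) (n : ℕ) :
    (adicMul I M (AdicCompletion.mk I _ x)).val n = (x n).val n := by
  rfl

theorem adicMul_map_of (M : Type u) [AddCommGroup M] [Module A M] (x : AdicCompletion I M) :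
    adicMul I M (AdicCompletion.map I (AdicCompletion.of I M) x) = x := by
  induction x using AdicCompletion.induction_on with
  | _ x =>
    ext n
    rw [AdicCompletion.map_mk, adicMul_val_mk]
    simp

theorem adicMul_naturality {M N : Type u} [AddCommGroup M] [Module A M] [AddCommGroup N]
    [Module A N] (f : M →ₗ[A] N) (x : AdicCompletion I (AdicCompletion I M)) :
    adicMul I N (AdicCompletion.map I ((AdicCompletion.map I f).restrictScalars A) x) =
      AdicCompletion.map I f (adicMul I M x) := by
  induction x using AdicCompletion.induction_on with
  | _ x =>
    ext n
    rw [AdicCompletion.map_mk, adicMul_val_mk, AdicCompletion.map_val_apply, adicMul_val_mk,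
      AdicCompletion.AdicCauchySequence.map_apply_coe, LinearMap.restrictScalars_apply,
      AdicCompletion.map_val_apply]

/-- The map `C^I(C^I(M)) → C^I(M)`, as a morphism. -/
def adicMulHom (M : ModuleCat.{u} A) :
    (adicFunctor I).obj ((adicFunctor I).obj M) ⟶ (adicFunctor I).obj M :=
  ModuleCat.ofHom (adicMul I M)

theorem adicMulHom_naturality {M N : ModuleCat.{u} A} (f : M ⟶ N) :
    (adicFunctor I).map ((adicFunctor I).map f) ≫ adicMulHom I N =
      adicMulHom I M ≫ (adicFunctor I).map f :=
  ModuleCat.hom_ext (LinearMap.ext fun x => adicMul_naturality I f.hom x)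

theorem map_toAdicMap_adicMulHom (M : ModuleCat.{u} A) :
    (adicFunctor I).map (toAdicMap I M) ≫ adicMulHom I M = 𝟙 _ :=
  ModuleCat.hom_ext (LinearMap.ext fun x => adicMul_map_of I M x)

/-- The composite `L₀ L₀ M → C^I(C^I(M)) → C^I(M)`. -/
def L₀Mul (M : ModuleCat.{u} A) : (L₀ I).obj ((L₀ I).obj M) ⟶ (adicFunctor I).obj M :=
  (toAdicCompletion I).app ((L₀ I).obj M) ≫ (adicFunctor I).map ((toAdicCompletion I).app M) ≫
    adicMulHom I M

/-- Naturality turns `L₀ η` into `C^I` of `M → C^I(M)`, which `adicMulHom` retracts. For projective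
`M` the right side is an isomorphism, so `L₀ η` is split injective. -/
theorem L₀_map_ηMap_L₀Mul (M : ModuleCat.{u} A) :
    (L₀ I).map (ηMap I M) ≫ L₀Mul I M = (toAdicCompletion I).app M := by
  have h : (adicFunctor I).map (ηMap I M) ≫ (adicFunctor I).map ((toAdicCompletion I).app M) =
      (adicFunctor I).map (toAdicMap I M) := by
    rw [← Functor.map_comp, ηMap_toAdicCompletion]
  rw [L₀Mul, (toAdicCompletion I).naturality_assoc, reassoc_of% h, map_toAdicMap_adicMulHom,
    Category.comp_id]

theorem L₀Mul_naturality {M N : ModuleCat.{u} A} (f : M ⟶ N) :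
    (L₀ I).map ((L₀ I).map f) ≫ L₀Mul I N = L₀Mul I M ≫ (adicFunctor I).map f := by
  simp only [L₀Mul, Category.assoc]
  rw [(toAdicCompletion I).naturality_assoc, ← Functor.map_comp_assoc,
    (toAdicCompletion I).naturality, Functor.map_comp_assoc, adicMulHom_naturality]

/-- The map that `η` induces on `L`-completions is injective. -/
theorem L₀_map_ηMap_injective (M : ModuleCat.{u} A) :
    Function.Injective ((L₀ I).map (ηMap I M)) := by
  rw [injective_iff_map_eq_zero]
  intro y hy
  let P := projectiveResolution M
  have := P.projective 0
  have := P.projective 1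
  obtain ⟨z, rfl⟩ := L₀_augmentation_surjective I P y
  -- The presentation `L₀ P₁ → L₀ P₀ → L₀ M` stays right exact after a second `L₀`, so the vanishing
  -- of `L₀ η` on the class of `z` produces `w` in `L₀ L₀ P₁`.
  have h := L₀_exact I _ _ (L₀_augmentation_exact I P) (L₀_augmentation_surjective I P)
  obtain ⟨w, hw⟩ := (h ((L₀ I).map (ηMap I _) z)).1 (by
    rw [← ModuleCat.comp_apply, ← Functor.map_comp, ← ηMap_naturality, Functor.map_comp,
      ModuleCat.comp_apply, hy])
  -- The retraction carries `w` back to `L₀ P₁`; its naturality shows that `v` maps to `z`.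
  obtain ⟨v, hv⟩ := (toAdicCompletion_bijective I (P.complex.X 1)).surjective (L₀Mul I _ w)
  rw [L₀_augmentation_exact I P z]
  refine ⟨v, (toAdicCompletion_bijective I _).injective ?_⟩
  rw [← L₀_map_ηMap_L₀Mul I (P.complex.X 0), ModuleCat.comp_apply _ _ z, ← hw,
    ← ModuleCat.comp_apply _ _ w, L₀Mul_naturality, ModuleCat.comp_apply _ _ w, ← hv,
    ← ModuleCat.comp_apply, ← ModuleCat.comp_apply, L₀_map_ηMap_L₀Mul,
    (toAdicCompletion I).naturality]

/-! ### Maps that are surjective modulo `I` -/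

/-- If `f` is surjective modulo `I`, then `L₀ f` is surjective. -/
theorem L₀_map_surjective_of_mkQ_comp_surjective {M N : ModuleCat.{u} A} (f : M ⟶ N)
    (hf : Function.Surjective ((I • (⊤ : Submodule A N)).mkQ ∘ₗ f.hom)) :
    Function.Surjective ((L₀ I).map f) := by
  let P := projectiveResolution M
  let Q := projectiveResolution N
  have := P.projective 0
  have := Q.projective 0
  have := Q.projective 1
  have hP : Function.Surjective (augmentation P) :=
    (ModuleCat.epi_iff_surjective _).1 inferInstance
  have hQ : Function.Surjective (augmentation Q) :=
    (ModuleCat.epi_iff_surjective _).1 inferInstance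
  have hQe : Function.Exact (Q.complex.d 1 0) (augmentation Q) :=
    (ShortComplex.ShortExact.moduleCat_exact_iff_function_exact _).1 Q.exact₀
  let h : P.complex.X 0 ⟶ Q.complex.X 0 :=
    Projective.factorThru (augmentation P ≫ f) (augmentation Q)
  have hh : h ≫ augmentation Q = augmentation P ≫ f := Projective.factorThru_comp _ _
  -- Adding the relations `Q₁` to `P₀` makes the map onto `Q₀` surjective modulo `I`, hence
  -- surjective on `I`-adic completions. The `Q₁` summand dies in `L₀ N`.
  let g := LinearMap.coprod (Q.complex.d 1 0).hom h.hom
  have hg : Function.Surjective (AdicCompletion.map I g) := by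
    apply AdicCompletion.map_surjective_of_mkQ_comp_surjective
    intro y
    obtain ⟨y, rfl⟩ := Submodule.mkQ_surjective _ y
    obtain ⟨x, hx⟩ := hf (Submodule.mkQ _ (augmentation Q y))
    obtain ⟨p, rfl⟩ := hP x
    -- An error in `I • N` lifts to some `z` in `I • Q₀`, as the augmentation is onto; what remains
    -- lies in its kernel, the image of `Q₁`.
    have h1 : augmentation Q (y - h p) ∈ (I • (⊤ : Submodule A (Q.complex.X 0))).map
        (augmentation Q).hom := by
      rw [Submodule.map_smul'', Submodule.map_top, LinearMap.range_eq_top.2 hQ, map_sub]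
      have h2 : augmentation Q (h p) = f (augmentation P p) := ConcreteCategory.congr_hom hh p
      rw [h2]
      exact (Submodule.Quotient.eq _).1 hx.symm
    obtain ⟨z, hz, hzy⟩ := h1
    obtain ⟨q, hq⟩ := (hQe (y - h p - z)).1 (by rw [map_sub, ← hzy]; exact sub_self _)
    refine ⟨(q, p), ?_⟩
    refine (Submodule.Quotient.eq _).2 ?_
    have h3 : g (q, p) - y = -z := by
      rw [LinearMap.coprod_apply]
      change Q.complex.d 1 0 q + h p - y = -z
      rw [hq]
      abel
    rw [h3]
    exact neg_mem hz
  intro y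
  obtain ⟨y, rfl⟩ := adicProj_surjective I Q y
  obtain ⟨x, rfl⟩ := hg y
  let x₁ : (adicFunctor I).obj (Q.complex.X 1) := AdicCompletion.map I (LinearMap.fst A _ _) x
  let x₂ : (adicFunctor I).obj (P.complex.X 0) := AdicCompletion.map I (LinearMap.snd A _ _) x
  have hx : AdicCompletion.map I g x =
      (adicFunctor I).map (Q.complex.d 1 0) x₁ + (adicFunctor I).map h x₂ := by
    induction x using AdicCompletion.induction_on with
    | _ x => ext n; rfl
  obtain ⟨b, hb⟩ := (toAdicCompletion_bijective I (P.complex.X 0)).surjective x₂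
  refine ⟨(L₀ I).map (augmentation P) b, ?_⟩
  rw [hx, map_add, (adicProj_exact I Q).apply_apply_eq_zero, zero_add, ← hb]
  simp only [← ModuleCat.comp_apply]
  rw [← (toAdicCompletion I).naturality, Category.assoc, toAdicCompletion_adicProj,
    ← Functor.map_comp, ← Functor.map_comp, hh]

variable {I} in
-- For finitely generated `I`, the kernel of `C^I(M) → M / I M` is exactly `I • C^I(M)`, so a lift
-- to `M` of the class of `y` in `M / I M` works.
theorem exists_of_sub_mem (hI : I.FG) {M : Type u} [AddCommGroup M] [Module A M]
    (y : AdicCompletion I M) :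
    ∃ p : M, AdicCompletion.of I M p - y ∈ I • (⊤ : Submodule A (AdicCompletion I M)) := by
  obtain ⟨p, hp⟩ := Submodule.mkQ_surjective _ (AdicCompletion.eval I _ 1 y)
  refine ⟨p, ?_⟩
  have h : AdicCompletion.of I M p - y ∈ I ^ 1 • (⊤ : Submodule A (AdicCompletion I M)) := by
    rw [AdicCompletion.pow_smul_top_eq_ker_eval hI, LinearMap.mem_ker, map_sub, ← hp,
      AdicCompletion.eval_of, sub_self]
  rwa [pow_one] at h

/-- `η` is surjective modulo `I`. -/
theorem ηMap_mkQ_comp_surjective (hI : I.FG) (M : ModuleCat.{u} A) :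
    Function.Surjective ((I • (⊤ : Submodule A ((L₀ I).obj M))).mkQ ∘ₗ (ηMap I M).hom) := by
  let P := projectiveResolution M
  intro y
  obtain ⟨y, rfl⟩ := Submodule.mkQ_surjective _ y
  obtain ⟨y, rfl⟩ := adicProj_surjective I P y
  obtain ⟨p, hp⟩ := exists_of_sub_mem hI (M := P.complex.X 0) y
  have h : toAdicMap I _ p - y ∈ I • (⊤ : Submodule A ((adicFunctor I).obj (P.complex.X 0))) := hp
  -- `η` is the map `P₀ → C^I(P₀)` followed by passage to the quotient `L₀ M`, so the approximation
  -- found in `C^I(P₀)` descends.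
  have h2 : augmentation P ≫ ηMap I M = toAdicMap I _ ≫ adicProj I P := by
    rw [← ηMap_toAdicCompletion, Category.assoc, toAdicCompletion_adicProj, ηMap_naturality]
  have h3 : ηMap I M (augmentation P p) = adicProj I P (toAdicMap I _ p) :=
    ConcreteCategory.congr_hom h2 p
  refine ⟨augmentation P p, (Submodule.Quotient.eq _).2 ?_⟩
  have h4 := Submodule.mem_map_of_mem (f := (adicProj I P).hom) h
  rw [Submodule.map_smul'', map_sub] at h4
  have h5 := Submodule.smul_mono (le_refl I)
    (le_top (a := (⊤ : Submodule A _).map (adicProj I P).hom))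
  have h6 := h5 h4
  rw [← h3] at h6
  exact h6

end Completion

/-! ### Tensor products with bimodules -/

namespace Bimod

variable {A : Type u} [CommRing A]

theorem tensor_hom_ext {X : Bimod A} {N K : ModuleCat.{u} A} {f g : X.tensor N ⟶ K}
    (h : ∀ n : N, tmulBy X n ≫ f = tmulBy X n ≫ g) : f = g := by
  ext t
  refine TensorProduct.induction_on (motive := fun t => f t = g t) t ?_ ?_ ?_
  · exact (map_zero f.hom).trans (map_zero g.hom).symm
  · exact fun x n => ConcreteCategory.congr_hom (h n) x
  · exact fun s t hs ht => (map_add f.hom s t).trans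
      ((congrArg₂ (· + ·) hs ht).trans (map_add g.hom s t).symm)

theorem tensorMap_comp {X Y Z : Bimod A} {K M N : ModuleCat.{u} A} (f : X ⟶ Y) (f' : Y ⟶ Z)
    (g : K ⟶ M) (g' : M ⟶ N) :
    tensorMap f g ≫ tensorMap f' g' = tensorMap (f ≫ f') (g ≫ g') :=
  tensor_hom_ext fun _ => rfl

theorem tensorMap_id_comp (X : Bimod A) {K M N : ModuleCat.{u} A} (g : K ⟶ M) (g' : M ⟶ N) :
    tensorMap (𝟙 X) g ≫ tensorMap (𝟙 X) g' = tensorMap (𝟙 X) (g ≫ g') := by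
  rw [tensorMap_comp, Category.comp_id]

theorem tensorMap_comp_id {X Y Z : Bimod A} (f : X ⟶ Y) (f' : Y ⟶ Z) (N : ModuleCat.{u} A) :
    tensorMap f (𝟙 N) ≫ tensorMap f' (𝟙 N) = tensorMap (f ≫ f') (𝟙 N) := by
  rw [tensorMap_comp, Category.comp_id]

theorem tensorMap_exchange {X Y : Bimod A} {M N : ModuleCat.{u} A} (f : X ⟶ Y) (g : M ⟶ N) :
    tensorMap (𝟙 X) g ≫ tensorMap f (𝟙 N) = tensorMap f (𝟙 M) ≫ tensorMap (𝟙 Y) g := by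
  rw [tensorMap_comp, tensorMap_comp, Category.id_comp, Category.comp_id, Category.id_comp,
    Category.comp_id]

theorem tensorMap_zero (X : Bimod A) (M N : ModuleCat.{u} A) :
    tensorMap (𝟙 X) (0 : M ⟶ N) = 0 :=
  tensor_hom_ext fun _ => ModuleCat.hom_ext (LinearMap.ext fun _ => TensorProduct.tmul_zero _ _)

theorem assoc_naturality {X X' Y Y' : Bimod A} {M N : ModuleCat.{u} A} (f : X ⟶ X') (g : Y ⟶ Y')
    (h : M ⟶ N) :
    tensorMap (prodMap f g) h ≫ assoc X' Y' N = assoc X Y M ≫ tensorMap f (tensorMap g h) :=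
  tensor_hom_ext fun _ => tensor_hom_ext fun _ => rfl

theorem assoc_naturality_right (X Y : Bimod A) {M N : ModuleCat.{u} A} (h : M ⟶ N) :
    tensorMap (𝟙 (X.prod Y)) h ≫ assoc X Y N =
      assoc X Y M ≫ tensorMap (𝟙 X) (tensorMap (𝟙 Y) h) :=
  tensor_hom_ext fun _ => tensor_hom_ext fun _ => rfl

theorem toComplete_naturality (I : Ideal A) {X Y : Bimod A} (f : X ⟶ Y) :
    f ≫ toComplete I Y = toComplete I X ≫ completeMap I f :=
  Hom.ext ((η I).naturality (Hom.hom f))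

theorem tensorMap_injective (X : Bimod A) [Module.Flat A X.Right] {M N : ModuleCat.{u} A}
    (g : M ⟶ N) (hg : Function.Injective g) : Function.Injective (tensorMap (𝟙 X) g) :=
  Module.Flat.lTensor_preserves_injective_linearMap (M := X.Right) g.hom hg

theorem tensorMap_exact (X : Bimod A) [Module.Flat A X.Right] {K M N : ModuleCat.{u} A}
    (f : K ⟶ M) (g : M ⟶ N) (h : Function.Exact f g) :
    Function.Exact (tensorMap (𝟙 X) f) (tensorMap (𝟙 X) g) :=
  Module.Flat.lTensor_exact X.Right (f := f.hom) (g := g.hom) h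

theorem tensorMap_surjective (X : Bimod A) {M N : ModuleCat.{u} A} (g : M ⟶ N)
    (hg : Function.Surjective g) : Function.Surjective (tensorMap (𝟙 X) g) :=
  LinearMap.lTensor_surjective X.Right (g := g.hom) hg

/-- `I` acts on `Y ⊗ N` through the left action on `Y`, so an error in `I • Y` tensored with `n`
stays in `I • (Y ⊗ N)`. -/
theorem tensorMap_mkQ_comp_surjective (I : Ideal A) {X Y : Bimod A} (f : X ⟶ Y)
    (hf : Function.Surjective ((I • (⊤ : Submodule A Y.left)).mkQ ∘ₗ (Hom.hom f).hom))
    (N : ModuleCat.{u} A) :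
    Function.Surjective ((I • (⊤ : Submodule A (Y.tensor N))).mkQ ∘ₗ
      (tensorMap f (𝟙 N)).hom) := by
  intro t
  obtain ⟨t, rfl⟩ := Submodule.mkQ_surjective _ t
  refine TensorProduct.induction_on (motive := fun t => ∃ s,
    ((I • (⊤ : Submodule A (Y.tensor N))).mkQ ∘ₗ (tensorMap f (𝟙 N)).hom) s =
      (I • (⊤ : Submodule A (Y.tensor N))).mkQ t) t ?_ ?_ ?_
  · exact ⟨0, (map_zero _).trans (map_zero _).symm⟩
  · intro y n
    obtain ⟨x, hx⟩ := hf (Submodule.mkQ _ (show Y.left from y))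
    refine ⟨X.tmul x n, (Submodule.Quotient.eq _).2 ?_⟩
    have h := Submodule.mem_map_of_mem (f := (tmulBy Y n).hom) ((Submodule.Quotient.eq _).1 hx)
    rw [Submodule.map_smul'', map_sub] at h
    exact Submodule.smul_mono (le_refl I) le_top h
  · rintro s t ⟨s', hs⟩ ⟨t', ht⟩
    exact ⟨s' + t', (map_add _ _ _).trans ((congrArg₂ (· + ·) hs ht).trans (map_add _ s t).symm)⟩

theorem boxMap_toComplete_surjective {I : Ideal A} (hI : I.FG) (X : Bimod A)
    (N : ModuleCat.{u} A) : Function.Surjective (boxMap I (toComplete I X) (𝟙 N)) :=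
  L₀_map_surjective_of_mkQ_comp_surjective I _
    (tensorMap_mkQ_comp_surjective I _ (ηMap_mkQ_comp_surjective I hI X.left) N)

/-- The additive map underlying `completeTensor`. -/
def completeTensorAux (I : Ideal A) (X : Bimod A) (N : ModuleCat.{u} A) :
    (X.complete I).Right ⊗[A] N →+ (L₀ I).obj (X.tensor N) :=
  TensorProduct.liftAddHom
    { toFun := fun x => AddMonoidHom.mk'
        (fun n => (L₀ I).map (tmulBy X n) (show (X.complete I).left from x))
        (fun m n => by
          have h : tmulBy X (m + n) = tmulBy X m + tmulBy X n :=
            ModuleCat.hom_ext (tmulBy_add X m n)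
          rw [h, Functor.map_add]
          rfl)
      map_zero' := AddMonoidHom.ext fun n => map_zero ((L₀ I).map (tmulBy X n)).hom
      map_add' := fun x y => AddMonoidHom.ext fun n => map_add ((L₀ I).map (tmulBy X n)).hom
        (show (X.complete I).left from x) (show (X.complete I).left from y) }
    -- Balancedness: the right action on `L₀ X` is `L₀` of the right action on `X`.
    (fun a x n => by
      have h : ModuleCat.ofHom (X.act a) ≫ tmulBy X n = tmulBy X (a • n) :=
        ModuleCat.hom_ext (LinearMap.ext fun y => act_tmul X a y n)
      have h' : (L₀ I).map (ModuleCat.ofHom (X.act a)) ≫ (L₀ I).map (tmulBy X n) =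
          (L₀ I).map (tmulBy X (a • n)) := by rw [← Functor.map_comp, h]
      exact ConcreteCategory.congr_hom h' (show (X.complete I).left from x))

/-- The natural map `L₀ X ⊗ N → L₀ (X ⊗ N)`. -/
def completeTensor (I : Ideal A) (X : Bimod A) (N : ModuleCat.{u} A) :
    (X.complete I).tensor N ⟶ (L₀ I).obj (X.tensor N) :=
  @ModuleCat.ofHom A _ ((X.complete I).tensor N) ((L₀ I).obj (X.tensor N)) _ _ _ _
    { toFun := completeTensorAux I X N
      map_add' := fun s t => map_add (completeTensorAux I X N) s t
      map_smul' := fun a t => by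
        refine TensorProduct.induction_on (motive := fun t =>
          completeTensorAux I X N (((X.complete I).lmul a).rTensor N t) =
          a • completeTensorAux I X N t) t ?_ ?_ ?_
        · simp
        · intro x n
          exact map_smul ((L₀ I).map (tmulBy X n)).hom a (show (X.complete I).left from x)
        · intro s t hs ht
          simp only [map_add, hs, ht, smul_add] }

/-- For each fixed `n` this is naturality of `η` along `- ⊗ n`. The resulting factorization of `η`
is what makes `X ⊠ N → L₀ X ⊠ N` injective. -/
theorem tensorMap_toComplete_completeTensor (I : Ideal A) (X : Bimod A) (N : ModuleCat.{u} A) :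
    tensorMap (toComplete I X) (𝟙 N) ≫ completeTensor I X N = ηMap I (X.tensor N) :=
  tensor_hom_ext fun n => (ηMap_naturality I (tmulBy X n)).symm

/-- `X ⊠ N → L₀ X ⊠ N` is injective. -/
theorem boxMap_toComplete_injective (I : Ideal A) (X : Bimod A) (N : ModuleCat.{u} A) :
    Function.Injective (boxMap I (toComplete I X) (𝟙 N)) := by
  have h := L₀_map_ηMap_injective I (X.tensor N)
  rw [← tensorMap_toComplete_completeTensor, Functor.map_comp] at h
  exact Function.Injective.of_comp h

/-- The map `X ⊗ N → X ⊠ N`. -/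
def toBox (I : Ideal A) (X : Bimod A) (N : ModuleCat.{u} A) : X.tensor N ⟶ X.box I N :=
  ηMap I (X.tensor N)

theorem toBox_naturality (I : Ideal A) {X Y : Bimod A} {M N : ModuleCat.{u} A} (f : X ⟶ Y)
    (g : M ⟶ N) : tensorMap f g ≫ toBox I Y N = toBox I X M ≫ boxMap I f g :=
  ηMap_naturality I (tensorMap f g)

theorem toUnitTensor_naturality {M N : ModuleCat.{u} A} (f : M ⟶ N) :
    f ≫ toUnitTensor N = toUnitTensor M ≫ tensorMap (𝟙 (unit A)) f := rfl

instance : Module.Flat A (unit A).Right := inferInstanceAs (Module.Flat A A)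

instance (N : ModuleCat.{u} A) : IsIso (toUnitTensor N) := by
  rw [ConcreteCategory.isIso_iff_bijective]
  exact (TensorProduct.lid A N).symm.bijective

/-- For `L`-complete `N`, the map `A ⊗ N → L₀ A ⊠ N` is injective. -/
theorem tensorMap_toComplete_toBox_mono (I : Ideal A) {N : ModuleCat.{u} A}
    (hN : IsLComplete I N) :
    Mono (tensorMap (toComplete I (unit A)) (𝟙 N) ≫ toBox I _ N) := by
  have h₁ : IsIso (ηMap I N) := hN
  have h₂ : Mono (boxMap I (toComplete I (unit A)) (𝟙 N)) :=
    (ModuleCat.mono_iff_injective _).2 (boxMap_toComplete_injective I _ N)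
  -- Through `N ≅ A ⊗ N`, the map `A ⊗ N → A ⊠ N` becomes `η` on `N`, an isomorphism by
  -- `L`-completeness.
  have h₃ : toUnitTensor N ≫ toBox I (unit A) N = ηMap I N ≫ (L₀ I).map (toUnitTensor N) :=
    ηMap_naturality I (toUnitTensor N)
  have h₄ : Mono (toUnitTensor N ≫ toBox I (unit A) N) := by
    have h : IsIso ((L₀ I).map (toUnitTensor N)) := Functor.map_isIso _ _
    rw [h₃]
    exact mono_comp' (@IsIso.mono_of_iso _ _ _ _ _ h₁) (@IsIso.mono_of_iso _ _ _ _ _ h)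
  have h₅ : Mono (toBox I (unit A) N) := by
    rw [← IsIso.inv_hom_id_assoc (toUnitTensor N) (toBox I (unit A) N)]
    exact mono_comp _ _
  rw [toBox_naturality]
  exact mono_comp _ _

end Bimod

/-! ### Pullbacks and lifts of modules -/

section Modules

variable {A : Type u} [CommRing A]

/-- Elements of a module are maps from `A`, so the universal property of the categorical pullback
yields elements. -/
theorem exists_pullback_fst {K L M : ModuleCat.{u} A} (f : K ⟶ M) (g : L ⟶ M) {k : K} {l : L}
    (h : f k = g l) : ∃ x : (Limits.pullback f g : ModuleCat.{u} A),
      Limits.pullback.fst f g x = k := by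
  let f' : ModuleCat.of A A ⟶ K := ModuleCat.ofHom (LinearMap.toSpanSingleton A K k)
  let g' : ModuleCat.of A A ⟶ L := ModuleCat.ofHom (LinearMap.toSpanSingleton A L l)
  have hfg : f' ≫ f = g' ≫ g := by
    apply ModuleCat.hom_ext
    apply LinearMap.ext_ring
    change f ((1 : A) • k) = g ((1 : A) • l)
    rw [one_smul, one_smul, h]
  refine ⟨Limits.pullback.lift f' g' hfg (1 : A), ?_⟩
  exact (ConcreteCategory.congr_hom (Limits.pullback.lift_fst f' g' hfg) (1 : A)).trans
    (one_smul A k)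

/-- This presents the pullback by a single exact pair, the form to which flatness applies. -/
theorem pullback_fst_exact {K L M : ModuleCat.{u} A} (f : K ⟶ M) (g : L ⟶ M) :
    Function.Exact (Limits.pullback.fst f g) (f ≫ Limits.cokernel.π g) := by
  have hg : Function.Exact g (Limits.cokernel.π g) :=
    (ShortComplex.ShortExact.moduleCat_exact_iff_function_exact
      (ShortComplex.mk g (Limits.cokernel.π g) (Limits.cokernel.condition g))).1
      (ShortComplex.exact_cokernel g)
  intro k
  constructor
  · intro hk
    obtain ⟨l, hl⟩ := (hg (f k)).1 hk
    exact exists_pullback_fst f g hl.symm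
  · rintro ⟨x, rfl⟩
    rw [← ModuleCat.comp_apply, Limits.pullback.condition_assoc, Limits.cokernel.condition,
      Limits.comp_zero]
    rfl

theorem exists_lift_of_forall_mem_range {K M N : ModuleCat.{u} A} (p : K ⟶ N) (g : M ⟶ N)
    (hg : Function.Injective g) (h : ∀ x, p x ∈ Set.range g) : ∃ r : K ⟶ M, r ≫ g = p := by
  let e := LinearEquiv.ofInjective g.hom hg
  refine ⟨ModuleCat.ofHom (e.symm.toLinearMap ∘ₗ p.hom.codRestrict _ h), ?_⟩
  ext x
  exact congrArg Subtype.val (e.apply_symm_apply ⟨p x, h x⟩)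

end Modules

/-! ### The comodule attached to an `L`-complete comodule -/

namespace HopfAlgebroid

variable {A Ψ : Type u} [CommRing A] [CommRing Ψ] (H : HopfAlgebroid A Ψ)

/-- The conjugation is an involution exchanging the two units, so it identifies the left module `Ψ`
with the right one, over which `Ψ ⊗ -` is formed. -/
theorem flat_right (hflat : H.ηL.Flat) : Module.Flat A H.bimod.Right := by
  have h : Module.Flat A (Via H.ηL) := hflat
  let e : Via H.ηL ≃ₗ[A] H.bimod.Right :=
    { toFun := fun x => H.c x
      invFun := fun x => H.c x
      left_inv := fun x => RingHom.congr_fun H.c_c x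
      right_inv := fun x => RingHom.congr_fun H.c_c x
      map_add' := fun x y => map_add H.c (show Ψ from x) (show Ψ from y)
      map_smul' := fun a x => by
        have h : H.c (H.ηL a * (show Ψ from x)) = H.ηR a * H.c x := by
          rw [map_mul]
          exact congrArg (· * H.c x) (RingHom.congr_fun H.c_ηL a)
        exact h }
  exact Module.Flat.of_linearEquiv e.symm

/-- The map `Ψ ⊗ K → Ψ^ ⊠ K`. -/
def tensorToBox (I : Ideal A) (K : ModuleCat.{u} A) :
    H.bimod.tensor K ⟶ (H.completed I).box I K :=
  Bimod.tensorMap (H.toCompleted I) (𝟙 K) ≫ Bimod.toBox I (H.completed I) K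

theorem tensorToBox_naturality (I : Ideal A) {K M : ModuleCat.{u} A} (f : K ⟶ M) :
    Bimod.tensorMap (𝟙 H.bimod) f ≫ H.tensorToBox I M =
      H.tensorToBox I K ≫ Bimod.boxMap I (𝟙 _) f := by
  rw [tensorToBox, tensorToBox, Category.assoc, ← Bimod.toBox_naturality,
    reassoc_of% Bimod.tensorMap_exchange]

theorem toCompleted_comulHat (I : Ideal A) :
    H.toCompleted I ≫ H.comulHat I =
      (H.comul ≫ Bimod.prodMap (H.toCompleted I) (H.toCompleted I)) ≫ Bimod.toComplete I _ :=
  (Bimod.toComplete_naturality I _).symm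

theorem toCompleted_counitHat (I : Ideal A) :
    H.toCompleted I ≫ H.counitHat I = H.counit ≫ Bimod.toComplete I _ :=
  (Bimod.toComplete_naturality I _).symm

/-- The map `Ψ ⊗ K → Ψ^ ⊠ Ψ^ ⊠ K` induced by the diagonal. -/
def tensorToTriple (I : Ideal A) (K : ModuleCat.{u} A) : H.bimod.tensor K ⟶ H.triple I K :=
  Bimod.tensorMap (H.comul ≫ Bimod.prodMap (H.toCompleted I) (H.toCompleted I)) (𝟙 K) ≫
    Bimod.toBox I ((H.completed I).prod (H.completed I)) K

/-- `Δ^` restricts to `Δ` along `Ψ → Ψ^`; the rest is naturality of `η`. -/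
theorem tensorToTriple_tripleToLeft (I : Ideal A) (K : ModuleCat.{u} A) :
    H.tensorToTriple I K ≫ H.tripleToLeft I K =
      H.tensorToBox I K ≫ Bimod.boxMap I (H.comulHat I) (𝟙 K) := by
  have h := Bimod.toBox_naturality I
    (Bimod.toComplete I ((H.completed I).prod (H.completed I))) (𝟙 K)
  refine (Category.assoc _ _ _).trans ?_
  refine (congrArg (Bimod.tensorMap (H.comul ≫
    Bimod.prodMap (H.toCompleted I) (H.toCompleted I)) (𝟙 K) ≫ ·) h.symm).trans ?_
  rw [tensorToBox, Category.assoc, ← Bimod.toBox_naturality, reassoc_of% Bimod.tensorMap_comp_id,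
    reassoc_of% Bimod.tensorMap_comp_id, toCompleted_comulHat]

theorem toBox_tripleToRight (I : Ideal A) (K : ModuleCat.{u} A) :
    Bimod.toBox I ((H.completed I).prod (H.completed I)) K ≫ H.tripleToRight I K =
      Bimod.assoc (H.completed I) (H.completed I) K ≫
        Bimod.tensorMap (𝟙 (H.completed I)) (Bimod.toBox I (H.completed I) K) ≫
          Bimod.toBox I (H.completed I) ((H.completed I).box I K) :=
  ((Category.assoc _ _ _).symm.trans
    (ηMap_naturality I (Bimod.assoc (H.completed I) (H.completed I) K ≫
      Bimod.tensorMap (𝟙 _) (Bimod.toBox I (H.completed I) K)))).symm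

/-- The right side ends in the map that `tensorToBox_injective` makes cancellable for `K = N`,
leaving `(1 ⊗ j) (Δ ⊗ 1)`. -/
theorem tensorToTriple_tripleToRight (I : Ideal A) (K : ModuleCat.{u} A) :
    H.tensorToTriple I K ≫ H.tripleToRight I K =
      Bimod.tensorMap H.comul (𝟙 K) ≫ Bimod.assoc H.bimod H.bimod K ≫
        Bimod.tensorMap (𝟙 H.bimod) (H.tensorToBox I K) ≫
          H.tensorToBox I ((H.completed I).box I K) := by
  refine (Category.assoc _ _ _).trans ?_
  refine (congrArg (Bimod.tensorMap (H.comul ≫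
    Bimod.prodMap (H.toCompleted I) (H.toCompleted I)) (𝟙 K) ≫ ·)
    (H.toBox_tripleToRight I K)).trans ?_
  have h : Bimod.tensorMap (H.toCompleted I) (Bimod.tensorMap (H.toCompleted I) (𝟙 K)) ≫
      Bimod.tensorMap (𝟙 (H.completed I)) (Bimod.toBox I (H.completed I) K) =
      Bimod.tensorMap (𝟙 H.bimod) (H.tensorToBox I K) ≫
        Bimod.tensorMap (H.toCompleted I) (𝟙 _) := by
    rw [Bimod.tensorMap_comp, Bimod.tensorMap_comp, Category.comp_id, Category.id_comp,
      Category.comp_id, tensorToBox]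
  rw [← Bimod.tensorMap_comp_id, Category.assoc, reassoc_of% Bimod.assoc_naturality, reassoc_of% h]
  rfl

/-! ### The coaction on `ν N` -/

namespace LCompleteComodule

variable {H} {I : Ideal A} (N : H.LCompleteComodule I)

theorem j_eq : N.j = H.tensorToBox I N.carrier :=
  (ηMap_naturality I (Bimod.tensorMap (H.toCompleted I) (𝟙 N.carrier))).symm

theorem j'_eq : N.j' = Bimod.tensorMap (𝟙 H.bimod) (Bimod.boxMap I (H.toCompleted I) (𝟙 _)) ≫
    H.tensorToBox I ((H.completed I).box I N.carrier) := by
  have h : N.j' = Bimod.toBox I _ _ ≫ Bimod.boxMap I (H.toCompleted I)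
    (Bimod.boxMap I (H.toCompleted I) (𝟙 N.carrier)) := rfl
  rw [h, ← Bimod.toBox_naturality, tensorToBox, reassoc_of% Bimod.tensorMap_comp, Category.id_comp,
    Category.comp_id]

/-- `j'` is this map preceded by the surjection `Ψ ⊗ (Ψ ⊠ N) → Ψ ⊗ (Ψ^ ⊠ N)`, so its injectivity
descends. -/
theorem tensorToBox_injective (hI : I.FG) (hj' : Function.Injective N.j') :
    Function.Injective (H.tensorToBox I ((H.completed I).box I N.carrier)) := by
  rw [j'_eq] at hj'
  have hs : Function.Surjective (Bimod.tensorMap (𝟙 H.bimod)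
      (Bimod.boxMap I (H.toCompleted I) (𝟙 N.carrier))) :=
    Bimod.tensorMap_surjective _ _ (Bimod.boxMap_toComplete_surjective hI H.bimod N.carrier)
  intro x y hxy
  obtain ⟨x, rfl⟩ := hs x
  obtain ⟨y, rfl⟩ := hs y
  rw [hj' hxy]

theorem condition : N.i ≫ N.coact = N.p ≫ N.j := Limits.pullback.condition

theorem i_injective (hj : Function.Injective N.j) : Function.Injective N.i := by
  have : Mono N.j := (ModuleCat.mono_iff_injective _).2 hj
  have h : Mono N.i := inferInstanceAs (Mono (Limits.pullback.fst N.coact N.j))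
  exact (ModuleCat.mono_iff_injective _).1 h

theorem tripleToLeft_injective : Function.Injective (H.tripleToLeft I N.carrier) :=
  Bimod.boxMap_toComplete_injective I _ _

/-- On `ν N`, the maps `1 ⊗ ψ` and `(1 ⊗ j) (Δ ⊗ 1)` agree after `p`. -/
theorem p_coassoc (hI : I.FG) (hj' : Function.Injective N.j') :
    N.p ≫ Bimod.tensorMap H.comul (𝟙 N.carrier) ≫ Bimod.assoc H.bimod H.bimod N.carrier ≫
      Bimod.tensorMap (𝟙 H.bimod) N.j = N.p ≫ Bimod.tensorMap (𝟙 H.bimod) N.coact := by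
  have : Mono (H.tensorToBox I ((H.completed I).box I N.carrier)) :=
    (ModuleCat.mono_iff_injective _).2 (N.tensorToBox_injective hI hj')
  have : Mono (H.tripleToLeft I N.carrier) :=
    (ModuleCat.mono_iff_injective _).2 N.tripleToLeft_injective
  obtain ⟨ψ₂, hR, hL⟩ := N.coassoc
  -- The two maps agree in `(Ψ^ ⊠ Ψ^) ⊠ N` by the `Δ^` half of coassociativity and the pullback
  -- square; `tripleToLeft` is injective, so they agree already in the triple product.
  have ht : N.p ≫ H.tensorToTriple I N.carrier = N.i ≫ ψ₂ := by
    rw [← cancel_mono (H.tripleToLeft I N.carrier), Category.assoc, Category.assoc, hL,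
      tensorToTriple_tripleToLeft, ← j_eq, ← Category.assoc, ← condition, Category.assoc]
  -- The same identity is now pushed to `Ψ^ ⊠ (Ψ^ ⊠ N)`, where the other half of coassociativity
  -- applies.
  rw [← cancel_mono (H.tensorToBox I ((H.completed I).box I N.carrier))]
  simp only [Category.assoc]
  rw [tensorToBox_naturality H I N.coact, ← j_eq, ← Category.assoc N.p N.j, ← condition,
    Category.assoc, ← hR, ← Category.assoc N.i, ← ht, Category.assoc,
    tensorToTriple_tripleToRight, j_eq]

/-- Since `N` is `L`-complete, `A ⊗ N` embeds in `A^ ⊠ N`, and there this is the counit axiom of `N`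
on `ν N`. -/
theorem p_counit : N.p ≫ Bimod.tensorMap H.counit (𝟙 N.carrier) =
    N.i ≫ Bimod.toUnitTensor N.carrier := by
  have := Bimod.tensorMap_toComplete_toBox_mono I N.complete
  rw [← cancel_mono (Bimod.tensorMap (Bimod.toComplete I (Bimod.unit A)) (𝟙 N.carrier) ≫
    Bimod.toBox I _ N.carrier)]
  have h : Bimod.tensorMap H.counit (𝟙 N.carrier) ≫
      Bimod.tensorMap (Bimod.toComplete I (Bimod.unit A)) (𝟙 N.carrier) ≫
      Bimod.toBox I _ N.carrier = N.j ≫ Bimod.boxMap I (H.counitHat I) (𝟙 N.carrier) := by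
    rw [j_eq, tensorToBox, Category.assoc, ← Bimod.toBox_naturality,
      reassoc_of% Bimod.tensorMap_comp_id, reassoc_of% Bimod.tensorMap_comp_id,
      toCompleted_counitHat]
  rw [Category.assoc, h, ← Category.assoc, ← condition, Category.assoc, N.counit, Category.assoc]
  rfl

theorem exists_lift_p (hI : I.FG) (hflat : H.ηL.Flat) (hj : Function.Injective N.j)
    (hj' : Function.Injective N.j') :
    ∃ ρ : N.ν ⟶ H.bimod.tensor N.ν, ρ ≫ Bimod.tensorMap (𝟙 H.bimod) N.i = N.p := by
  have := H.flat_right hflat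
  have hjq : Bimod.tensorMap (𝟙 H.bimod) N.j ≫
      Bimod.tensorMap (𝟙 H.bimod) (Limits.cokernel.π N.j) = 0 := by
    rw [Bimod.tensorMap_id_comp, Limits.cokernel.condition, Bimod.tensorMap_zero]
  -- By `p_coassoc`, `(1 ⊗ ψ) p` factors through `1 ⊗ j`, so it vanishes in `Ψ ⊗ coker j`.
  have h : N.p ≫ Bimod.tensorMap (𝟙 H.bimod) (N.coact ≫ Limits.cokernel.π N.j) = 0 := by
    rw [← Bimod.tensorMap_id_comp, ← Category.assoc, ← N.p_coassoc hI hj']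
    simp only [Category.assoc, hjq, Limits.comp_zero]
  have hex := Bimod.tensorMap_exact H.bimod _ _ (pullback_fst_exact N.coact N.j)
  exact exists_lift_of_forall_mem_range N.p _
    (Bimod.tensorMap_injective H.bimod N.i (N.i_injective hj))
    fun x => (hex _).1 (ConcreteCategory.congr_hom h x)

theorem isCoaction_of_lift (hI : I.FG) (hflat : H.ηL.Flat) (hj : Function.Injective N.j)
    (hj' : Function.Injective N.j') (ρ : N.ν ⟶ H.bimod.tensor N.ν)
    (hρ : ρ ≫ Bimod.tensorMap (𝟙 H.bimod) N.i = N.p) : H.IsCoaction ρ where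
  counit := by
    have : Mono (Bimod.tensorMap (𝟙 (Bimod.unit A)) N.i) :=
      (ModuleCat.mono_iff_injective _).2 (Bimod.tensorMap_injective _ _ (N.i_injective hj))
    rw [← cancel_mono (Bimod.tensorMap (𝟙 (Bimod.unit A)) N.i), ← Bimod.toUnitTensor_naturality,
      ← N.p_counit, ← hρ, Category.assoc, Category.assoc, Bimod.tensorMap_exchange]
  coassoc := by
    have := H.flat_right hflat
    -- By flatness `1 ⊗ i₂` embeds `Ψ ⊗ (Ψ ⊗ ν N)` in `Ψ ⊗ (Ψ^ ⊠ N)`, where the two sides of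
    -- coassociativity become the two sides of `p_coassoc`.
    let i₂ : H.bimod.tensor N.ν ⟶ (H.completed I).box I N.carrier :=
      Bimod.tensorMap (𝟙 H.bimod) N.i ≫ N.j
    have hi₂ : Function.Injective i₂ :=
      hj.comp (Bimod.tensorMap_injective _ _ (N.i_injective hj))
    have : Mono (Bimod.tensorMap (𝟙 H.bimod) i₂) :=
      (ModuleCat.mono_iff_injective _).2 (Bimod.tensorMap_injective _ _ hi₂)
    have h₁ : ρ ≫ Bimod.tensorMap (𝟙 H.bimod) ρ ≫ Bimod.tensorMap (𝟙 H.bimod) i₂ =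
        N.p ≫ Bimod.tensorMap (𝟙 H.bimod) N.coact := by
      have h : ρ ≫ i₂ = N.i ≫ N.coact := by
        rw [condition, ← hρ, Category.assoc]
      rw [Bimod.tensorMap_id_comp, h, ← hρ, Category.assoc, Bimod.tensorMap_id_comp]
    rw [← cancel_mono (Bimod.tensorMap (𝟙 H.bimod) i₂), Category.assoc ρ (Bimod.tensorMap _ ρ) _,
      h₁, ← N.p_coassoc hI hj', ← Bimod.tensorMap_id_comp, ← hρ]
    simp only [Category.assoc]
    rw [← reassoc_of% Bimod.assoc_naturality_right, ← reassoc_of% Bimod.tensorMap_exchange]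

end LCompleteComodule
end HopfAlgebroid

end LComp

end

theorem mainTheorem4 {A Ψ : Type u} [CommRing A] [IsRegularLocalRing A] [CommRing Ψ]
    (H : LComp.HopfAlgebroid A Ψ) (hflat : H.ηL.Flat)
    (hinv : (IsLocalRing.maximalIdeal A).map H.ηR ≤ (IsLocalRing.maximalIdeal A).map H.ηL)
    (N : H.LCompleteComodule (IsLocalRing.maximalIdeal A))
    (hj : Function.Injective N.j) (hj' : Function.Injective N.j') :
    Function.Injective N.i ∧
      ∃ ρ : N.ν ⟶ H.bimod.tensor N.ν,
        H.IsCoaction ρ ∧ ρ ≫ LComp.Bimod.tensorMap (𝟙 H.bimod) N.i = N.p := by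
  have hI : (IsLocalRing.maximalIdeal A).FG := IsNoetherian.noetherian _
  obtain ⟨ρ, hρ⟩ := N.exists_lift_p hI hflat hj hj'
  exact ⟨N.i_injective hj, ρ, N.isCoaction_of_lift hI hflat hj hj' ρ hρ, hρ⟩
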